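/- Let $n\ge 1$ and let $x_1>x_2>\dots>x_n$ be integers. An interlacing particle system (Gelfand--Tsetlin pattern) with top row $x$ is a triangular array of integers $y^r=(y^r_1,\dots,y^r_r)$, $1\le r\le n$, with $y^n=(x_1,\dots,x_n)$ and $$y_i^{r+1}\ge y_i^r>y_{i+1}^{r+1}\qquad(1\le i\le r,\ 1\le r<n).$$ There are finitely many of these and at least one. Choose one uniformly at random and consider the point process $\sum_{r=1}^{n-1}\sum_{i=1}^r\delta_{(r,y_i^r)}$ formed by the particles below the fixed top row on $\mathfrak X=\{1,\dots,n-1\}\times\mathbb Z$, with counting measure as reference measure. For every $u\in\mathbb Z$ let $\Gamma_u$ be a closed, positively oriented, piecewise $C^1$ contour which contains all $x_j$ with $x_j\ge u$ in its interior and has all $x_j$ with $x_j<u$ in its exterior. For $(r,u),(s,v)\in\mathfrak X$ let $\gamma$ be a closed, positively oriented, piecewise $C^1$ contour which contains $\Gamma_u$ and the points $v-n+s,\,v-n+s+1,\dots,v$ in its interior. (Here a point is in the interior, respectively the exterior, of a contour if it does not lie on the contour and the winding number of the contour about it is $1$, respectively $0$.) Then the point process is determinantal, and for every such choice of contours a correlation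 kernel is $$K(r,u;s,v)=-\mathbf 1_{r<s}\mathbf 1_{u\le v}\frac{(v-u+1)_{s-r-1}}{(s-r-1)!}+\frac{(n-s)!}{(n-r-1)!}\frac1{(2\pi\mathrm i)^2}\int_{\gamma}dw\int_{\Gamma_u}dz\,\frac{\prod_{k=u+r-n+1}^{u-1}(z-k)}{\prod_{k=v+s-n}^{v}(w-k)}\prod_{i=1}^n\frac{w-x_i}{z-x_i}\,\frac1{w-z},$$ where $(a)_m=a(a+1)\cdots(a+m-1)$ and empty products are $1$. That the process is determinantal with correlation kernel $K$ means that for every bounded function $\phi:\mathfrak X\to\mathbb C$ with bounded support $$\mathbb E\Big[\prod_{\text{particles }a}(1-\phi(a))\Big]=\sum_{k=0}^\infty\frac{(-1)^k}{k!}\sum_{a_1,\dots,a_k\in\mathfrak X}\ \prod_{j=1}^k\phi(a_j)\ \det\big(K(a_i,a_j)\big)_{1\le i,j\le k},$$ where all sums converge and the term with $k=0$ is $1$. -/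

import Mathlib

open MeasureTheory Set

noncomputable section

/-! ### Point processes and determinantal point processes -/

/-- The space of boundedly finite counting measures on a metric space `X`:
measures giving every bounded measurable set a value in `{0, 1, 2, …}`. -/
def PointConfig (X : Type*) [MetricSpace X] [MeasurableSpace X] : Type _ :=
  {ξ : Measure X // ∀ B : Set X, MeasurableSet B → Bornology.IsBounded B → ∃ k : ℕ, ξ B = k}

/-- The smallest σ-algebra making all the maps `ξ ↦ ξ B`, `B` measurable, measurable. -/
instance (X : Type*) [MetricSpace X] [MeasurableSpace X] : MeasurableSpace (PointConfig X) :=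
  inferInstanceAs (MeasurableSpace {ξ : Measure X //
    ∀ B : Set X, MeasurableSet B → Bornology.IsBounded B → ∃ k : ℕ, ξ B = k})

/-- The number of particles of the configuration `ξ` at the point `a`. -/
def PointConfig.multiplicity {X : Type*} [MetricSpace X] [MeasurableSpace X]
    (ξ : PointConfig X) (a : X) : ℕ :=
  ⌊(ξ.1 {a}).toReal⌋₊

/-- The product `∏ᵢ (1 - φ(xᵢ))` over the particles `xᵢ` of the configuration `ξ`, counted with
multiplicity. If `φ` has bounded support, only finitely many factors differ from `1`. -/
def PointConfig.prodOneSub {X : Type*} [MetricSpace X] [MeasurableSpace X]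
    (ξ : PointConfig X) (φ : X → ℂ) : ℂ :=
  ∏ᶠ a : X, (1 - φ a) ^ ξ.multiplicity a

/-- The point process with law `P` has correlation functions `ρ k`, `k ≥ 1`, with respect to the
reference measure `ν`: for all bounded `φ` with bounded support
`E[∏ᵢ (1 - φ(xᵢ))] = ∑ₖ (-1)ᵏ/k! ∫ ∏ⱼ φ(xⱼ) ρₖ(x₁, …, xₖ) dνᵏ(x)`, with `k = 0` term `1`. -/
def HasCorrelationFunctions {X : Type*} [MetricSpace X] [MeasurableSpace X]
    (P : Measure (PointConfig X)) (ν : Measure X) (ρ : (k : ℕ) → (Fin k → X) → ℂ) : Prop :=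
  (∀ k, Measurable (ρ k)) ∧ (∀ a, ρ 0 a = 1) ∧
  ∀ φ : X → ℂ, Measurable φ → (∃ C : ℝ, ∀ a, ‖φ a‖ ≤ C) →
    Bornology.IsBounded (Function.support φ) →
      Integrable (fun ξ : PointConfig X => ξ.prodOneSub φ) P ∧
      (∀ k : ℕ, Integrable (fun a : Fin k → X => (∏ j, φ (a j)) * ρ k a)
        (Measure.pi fun _ : Fin k => ν)) ∧
      HasSum (fun k : ℕ => (-1 : ℂ) ^ k / (k.factorial : ℂ) *
          ∫ a : Fin k → X, (∏ j, φ (a j)) * ρ k a ∂(Measure.pi fun _ : Fin k => ν))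
        (∫ ξ : PointConfig X, ξ.prodOneSub φ ∂P)

/-- `P` is the law of a determinantal point process with correlation kernel `K` and reference
measure `ν`: its correlation functions are `ρ k (x₁, …, xₖ) = det (K (xᵢ, xⱼ))`. -/
def IsDeterminantal {X : Type*} [MetricSpace X] [MeasurableSpace X]
    (P : Measure (PointConfig X)) (ν : Measure X) (K : X → X → ℂ) : Prop :=
  IsProbabilityMeasure P ∧ Measurable (Function.uncurry K) ∧
    HasCorrelationFunctions P ν fun k a => (Matrix.of fun i j : Fin k => K (a i) (a j)).det

/-! ### The uniform interlacing particle system -/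

/-- Triangular arrays of integers `y^r = (y^r_1, …, y^r_r)`, `0 ≤ r ≤ n` (row `0` is empty);
the entry `y^r_{i+1}` is `y r i`. -/
abbrev TriangularArray (n : ℕ) : Type := (r : Fin (n + 1)) → Fin r → ℤ

/-- The interlacing particle systems (Gelfand–Tsetlin patterns) with top row `x`:
`y^{r+1}_i ≥ y^r_i > y^{r+1}_{i+1}` for `1 ≤ i ≤ r < n`, and `y^n = x`. -/
def gtPatterns {n : ℕ} (x : Fin n → ℤ) : Set (TriangularArray n) :=
  {y | (∀ (r : ℕ) (hr : r < n) (i : ℕ) (hi : i < r),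
          y ⟨r, by omega⟩ ⟨i, hi⟩ ≤ y ⟨r + 1, by omega⟩ ⟨i, by simp; omega⟩ ∧
          y ⟨r + 1, by omega⟩ ⟨i + 1, by simp; omega⟩ < y ⟨r, by omega⟩ ⟨i, hi⟩) ∧
       ∀ i : Fin n, y (Fin.last n) i = x i}

/-- The space `{1, …, n - 1} × ℤ` of pairs (row, position) in which the particles below the
fixed top row live. -/
abbrev Site (n : ℕ) : Type := ↥(Set.Ico 1 n) × ℤ

/-- The counting measure `∑_{1 ≤ r < n} ∑_{1 ≤ i ≤ r} δ_{(r, y^r_i)}`. -/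
def particleMeasure {n : ℕ} (y : TriangularArray n) : Measure (Site n) :=
  ∑ r : ↥(Set.Ico 1 n), ∑ i : Fin (r : ℕ),
    Measure.dirac (r, y ⟨r, Nat.lt_succ_of_lt r.2.2⟩ i)

theorem particleMeasure_nat {n : ℕ} (y : TriangularArray n) (B : Set (Site n))
    (hB : MeasurableSet B) : ∃ k : ℕ, particleMeasure y B = k := by
  classical
  refine ⟨∑ r : ↥(Set.Ico 1 n), ∑ i : Fin (r : ℕ),
    if (r, y ⟨r, Nat.lt_succ_of_lt r.2.2⟩ i) ∈ B then 1 else 0, ?_⟩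
  simp [particleMeasure, Measure.dirac_apply' _ hB, Set.indicator_apply]

/-- The particle configuration of the rows `1, …, n - 1` of `y`. -/
def particles {n : ℕ} (y : TriangularArray n) : PointConfig (Site n) :=
  ⟨particleMeasure y, fun B hB _ => particleMeasure_nat y B hB⟩

/-- The law of the particle configuration of a uniformly random interlacing particle system with
top row `x`. -/
def interlacingProcess {n : ℕ} (x : Fin n → ℤ) : Measure (PointConfig (Site n)) :=
  (ProbabilityTheory.uniformOn (gtPatterns x)).map particles

/-! ### Contours and the kernel -/

/-- A closed piecewise continuously differentiable curve in `ℂ`, parametrized by `[0, 1]`. -/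
structure ClosedContour where
  toFun : ℝ → ℂ
  closed : toFun 0 = toFun 1
  piecewise_contDiff : ∃ (m : ℕ) (τ : ℕ → ℝ), τ 0 = 0 ∧ τ m = 1 ∧ Monotone τ ∧
    ∀ i < m, ContDiffOn ℝ 1 toFun (Set.Icc (τ i) (τ (i + 1)))

namespace ClosedContour

/-- The points of the curve. -/
def trace (c : ClosedContour) : Set ℂ := c.toFun '' Set.Icc 0 1

/-- The contour integral `∫_c f(z) dz`. -/
def integral (c : ClosedContour) (f : ℂ → ℂ) : ℂ :=
  ∫ t in (0 : ℝ)..1, f (c.toFun t) * deriv c.toFun t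

/-- The winding number of `c` about a point `p` not on `c`. -/
def windingNumber (c : ClosedContour) (p : ℂ) : ℂ :=
  (2 * Real.pi * Complex.I)⁻¹ * c.integral fun z => (z - p)⁻¹

/-- `c` contains `p` in its interior (and is positively oriented). -/
def Encloses (c : ClosedContour) (p : ℂ) : Prop := p ∉ c.trace ∧ c.windingNumber p = 1

/-- `p` lies outside `c`. -/
def Excludes (c : ClosedContour) (p : ℂ) : Prop := p ∉ c.trace ∧ c.windingNumber p = 0

end ClosedContour

/-- The kernel `K(r,u;s,v)` of the interlacing particle system, for given contours: `Γ` for the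
variable `z` and `γ` for the variable `w`. Here `(a)_m = a (a+1) ⋯ (a+m-1)` is
`ascPochhammer`; the natural number subtractions occur only where they do not truncate. -/
def interlacingKernel {n : ℕ} (x : Fin n → ℤ) (Γ γ : ClosedContour) (p q : Site n) : ℂ :=
  let r : ℕ := p.1
  let u : ℤ := p.2
  let s : ℕ := q.1
  let v : ℤ := q.2
  (if r < s ∧ u ≤ v then
      -((ascPochhammer ℂ (s - r - 1)).eval ((v : ℂ) - u + 1) / ((s - r - 1).factorial : ℂ))
    else 0) +
    ((n - s).factorial : ℂ) / ((n - r - 1).factorial : ℂ) *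
      (1 / (2 * Real.pi * Complex.I) ^ 2) *
      γ.integral fun w => Γ.integral fun z =>
        (∏ k ∈ Finset.Icc (u + r - n + 1) (u - 1), (z - k)) /
            (∏ k ∈ Finset.Icc (v + s - n) v, (w - k)) *
          (∏ i : Fin n, (w - x i) / (z - x i)) * (1 / (w - z))

end

/-!
The proof identifies `E[∏ (1 - φ)]` with a finite Fredholm determinant by exhibiting `-K` as the
Green's function of a system of difference equations.

For a weight `g` on the sites, consider the families `f 1, …, f n` of functions on `ℤ` with
`f (s + 1) v - f (s + 1) (v - 1) = g s v * f s v` and `f 1` constant. Summing out one row of an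
interlacing pattern after the other shows that the weighted number of patterns with top row `x` is
`det (f_a n (x b))`, where `f_1, …, f_n` is the basis of solutions normalised at a base point to the
left of everything (`exists_finset_gtPatterns`).

For `g = 1` the solutions are the iterated differences of polynomials of degree less than `n`, and
the Lagrange basis polynomials of the points `x b` give the basis of solutions `V j` whose values at
the top row form the identity matrix (`topSolution`). The residue theorem shows that
`K (r, u; s, v) = -τ (s - r) u v + ∑ j, τ (n - r) u (x j) * V j s v`, with `τ m` the `m`-fold
convolution power of `1_{u ≤ v}` (`rowTransition`, `interlacingKernel_eq`). The pole `w = z` does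
not contribute, since `w` lies outside the inner contour (`ClosedContour.excludes_of_encloses`).

For `g = 1 - φ` Duhamel's formula (`evolve_one_sub_eq`) relates the perturbed to the unperturbed
solutions, and with `det (1 - A B) = det (1 - B A)` it turns `det (1 - φ K)` into the determinant of
the perturbed solutions at the top row (`det_one_sub_mul_kernel`). A change of basis, whose determinant is found
from the case `φ = 0`, identifies this with the weighted number of patterns divided by their number
(`sum_patternWeight_eq`). Finally `det (1 - φ K)` is expanded into its principal minors
(`Matrix.hasSum_fredholm`).
-/

/-! ### Residue calculus for piecewise `C¹` contours -/

namespace ClosedContour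

theorem continuousOn (c : ClosedContour) : ContinuousOn c.toFun (Icc 0 1) := by
  obtain ⟨m, τ, h0, h1, hmono, hd⟩ := c.piecewise_contDiff
  have key : ∀ i ≤ m, ContinuousOn c.toFun (Icc (τ 0) (τ i)) := by
    intro i
    induction i with
    | zero => intro _; simp
    | succ i ih =>
      intro hi
      rw [← Icc_union_Icc_eq_Icc (hmono (Nat.zero_le i)) (hmono (Nat.le_succ i))]
      exact (ih (by omega)).union_of_isClosed (hd i (by omega)).continuousOn isClosed_Icc isClosed_Icc
  simpa [h0, h1] using key m le_rfl

theorem isCompact_trace (c : ClosedContour) : IsCompact c.trace :=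
  isCompact_Icc.image_of_continuousOn c.continuousOn

theorem trace_nonempty (c : ClosedContour) : c.trace.Nonempty :=
  (nonempty_Icc.2 zero_le_one).image _

theorem isPreconnected_trace (c : ClosedContour) : IsPreconnected c.trace :=
  isPreconnected_Icc.image _ c.continuousOn

/-- On an interval where the contour is `C¹` the integrand of a contour integral is integrable:
the two-sided derivative agrees with the one-sided one except at the end points. -/
theorem intervalIntegrable_piece (c : ClosedContour) {f : ℂ → ℂ} (hf : ContinuousOn f c.trace)
    {a b : ℝ} (hab : a ≤ b) (hsub : Icc a b ⊆ Icc 0 1) (hd : ContDiffOn ℝ 1 c.toFun (Icc a b)) :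
    IntervalIntegrable (fun t => f (c.toFun t) * deriv c.toFun t) volume a b := by
  rcases hab.eq_or_lt with rfl | hlt
  · simp
  have hcont : ContinuousOn (fun t => f (c.toFun t) * derivWithin c.toFun (Icc a b) t)
      (Icc a b) := by
    refine ContinuousOn.mul ?_ (hd.continuousOn_derivWithin (uniqueDiffOn_Icc hlt) le_rfl)
    exact hf.comp hd.continuousOn fun t ht => mem_image_of_mem _ (hsub ht)
  refine (hcont.intervalIntegrable_of_Icc hab).congr_uIoo fun t ht => ?_
  rw [uIoo_of_le hab] at ht
  simp only
  rw [derivWithin_of_mem_nhds (Icc_mem_nhds ht.1 ht.2)]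

theorem intervalIntegrable (c : ClosedContour) {f : ℂ → ℂ} (hf : ContinuousOn f c.trace) :
    IntervalIntegrable (fun t => f (c.toFun t) * deriv c.toFun t) volume 0 1 := by
  obtain ⟨m, τ, h0, h1, hmono, hd⟩ := c.piecewise_contDiff
  rw [← h0, ← h1]
  refine IntervalIntegrable.trans_iterate fun i hi => ?_
  refine c.intervalIntegrable_piece hf (hmono (Nat.le_succ i)) ?_ (hd i hi)
  exact Icc_subset_Icc (h0 ▸ hmono (Nat.zero_le i)) (h1 ▸ hmono hi)

/-- The fundamental theorem of calculus along a closed contour. -/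
theorem integral_eq_zero_of_hasDerivAt (c : ClosedContour) {F f : ℂ → ℂ}
    (hF : ∀ z ∈ c.trace, HasDerivAt F (f z) z) (hf : ContinuousOn f c.trace) :
    c.integral f = 0 := by
  obtain ⟨m, τ, h0, h1, hmono, hd⟩ := c.piecewise_contDiff
  have hsub : ∀ i < m, Icc (τ i) (τ (i + 1)) ⊆ Icc 0 1 := fun i hi =>
    Icc_subset_Icc (h0 ▸ hmono (Nat.zero_le i)) (h1 ▸ hmono hi)
  have hint : ∀ i < m, IntervalIntegrable (fun t => f (c.toFun t) * deriv c.toFun t) volume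
      (τ i) (τ (i + 1)) := fun i hi =>
    c.intervalIntegrable_piece hf (hmono (Nat.le_succ i)) (hsub i hi) (hd i hi)
  have hpiece : ∀ i < m, ∫ t in (τ i)..(τ (i + 1)), f (c.toFun t) * deriv c.toFun t =
      F (c.toFun (τ (i + 1))) - F (c.toFun (τ i)) := by
    intro i hi
    refine intervalIntegral.integral_eq_sub_of_hasDerivAt_of_le (f := fun t => F (c.toFun t))
      (hmono (Nat.le_succ i)) ?_ (fun t ht => ?_) (hint i hi)
    · intro t ht
      exact (hF _ (mem_image_of_mem _ (hsub i hi ht))).continuousAt.comp_continuousWithinAt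
        ((hd i hi).continuousOn t ht)
    · have hdt : DifferentiableAt ℝ c.toFun t :=
        ((hd i hi).differentiableOn one_ne_zero).differentiableAt (Icc_mem_nhds ht.1 ht.2)
      exact (hF _ (mem_image_of_mem _ (hsub i hi (Ioo_subset_Icc_self ht)))).comp_of_eq t
        hdt.hasDerivAt rfl
  unfold integral
  rw [← h0, ← h1, ← intervalIntegral.sum_integral_adjacent_intervals hint,
    Finset.sum_congr rfl fun i hi => hpiece i (Finset.mem_range.1 hi),
    Finset.sum_range_sub fun i => F (c.toFun (τ i)), h0, h1, c.closed, sub_self]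

theorem integral_congr (c : ClosedContour) {f g : ℂ → ℂ} (h : ∀ z ∈ c.trace, f z = g z) :
    c.integral f = c.integral g := by
  refine intervalIntegral.integral_congr fun t ht => ?_
  rw [uIcc_of_le zero_le_one] at ht
  simp only [h _ (mem_image_of_mem _ ht)]

theorem integral_add (c : ClosedContour) {f g : ℂ → ℂ} (hf : ContinuousOn f c.trace)
    (hg : ContinuousOn g c.trace) :
    c.integral (fun z => f z + g z) = c.integral f + c.integral g := by
  unfold integral
  rw [← intervalIntegral.integral_add (c.intervalIntegrable hf) (c.intervalIntegrable hg)]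
  simp only [add_mul]

theorem integral_const_mul (c : ClosedContour) (a : ℂ) (f : ℂ → ℂ) :
    c.integral (fun z => a * f z) = a * c.integral f := by
  unfold integral
  simp only [mul_assoc, intervalIntegral.integral_const_mul]

theorem integral_finsetSum (c : ClosedContour) {ι : Type*} (s : Finset ι) {f : ι → ℂ → ℂ}
    (hf : ∀ i ∈ s, ContinuousOn (f i) c.trace) :
    c.integral (fun z => ∑ i ∈ s, f i z) = ∑ i ∈ s, c.integral (f i) := by
  unfold integral
  rw [← intervalIntegral.integral_finsetSum fun i hi => c.intervalIntegrable (hf i hi)]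
  simp only [Finset.sum_mul]

theorem continuousOn_inv_sub (c : ClosedContour) {p : ℂ} (hp : p ∉ c.trace) :
    ContinuousOn (fun z : ℂ => (z - p)⁻¹) c.trace :=
  (continuousOn_id.sub continuousOn_const).inv₀ fun z hz h => hp ((sub_eq_zero.1 h : z = p) ▸ hz)

theorem integral_inv_sub (c : ClosedContour) (p : ℂ) :
    c.integral (fun z => (z - p)⁻¹) = 2 * Real.pi * Complex.I * c.windingNumber p := by
  rw [windingNumber, ← mul_assoc, mul_inv_cancel₀ Complex.two_pi_I_ne_zero, one_mul]

/-- The integrand `(z - q)⁻¹ - (z - p)⁻¹` has the primitive `log ((z - q) / (z - p))` near the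
contour when `q` is close to `p`. -/
theorem exists_windingNumber_eq (c : ClosedContour) {p : ℂ} (hp : p ∉ c.trace) :
    ∃ ε > 0, ∀ q, dist q p < ε → c.windingNumber q = c.windingNumber p := by
  obtain ⟨ε, hε, hball⟩ := Metric.isOpen_iff.1 c.isCompact_trace.isClosed.isOpen_compl p hp
  refine ⟨ε, hε, fun q hq => ?_⟩
  have hq' : q ∉ c.trace := hball (Metric.mem_ball.2 hq)
  have hzp : ∀ z ∈ c.trace, z - p ≠ 0 := fun z hz h => hp (sub_eq_zero.1 h ▸ hz)
  have hzq : ∀ z ∈ c.trace, z - q ≠ 0 := fun z hz h => hq' (sub_eq_zero.1 h ▸ hz)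
  have h := c.integral_eq_zero_of_hasDerivAt (F := fun z => Complex.log ((z - q) / (z - p)))
    (f := fun z => (z - q)⁻¹ + (-1) * (z - p)⁻¹) (fun z hz => ?_)
    ((c.continuousOn_inv_sub hq').add (continuousOn_const.mul (c.continuousOn_inv_sub hp)))
  · rw [c.integral_add (g := fun z => (-1) * (z - p)⁻¹) (c.continuousOn_inv_sub hq')
      (continuousOn_const.mul (c.continuousOn_inv_sub hp)), c.integral_const_mul] at h
    unfold windingNumber
    congr 1
    linear_combination h
  · have hslit : (z - q) / (z - p) ∈ Complex.slitPlane := by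
      have hlt : ‖(z - q) / (z - p) - 1‖ < 1 := by
        have hd : ε ≤ ‖z - p‖ := by
          by_contra! hlt
          exact hball (Metric.mem_ball.2 (by rwa [dist_eq_norm])) hz
        rw [div_sub_one (hzp z hz), norm_div, div_lt_one (hε.trans_le hd)]
        refine lt_of_lt_of_le ?_ hd
        rw [show z - q - (z - p) = -(q - p) by ring, norm_neg, ← dist_eq_norm]
        exact hq
      refine Or.inl ?_
      have := (abs_le.1 (Complex.abs_re_le_norm ((z - q) / (z - p) - 1))).1
      rw [Complex.sub_re, Complex.one_re] at this
      linarith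
    have hd := (((hasDerivAt_id' z).sub_const q).fun_div ((hasDerivAt_id' z).sub_const p)
      (hzp z hz)).clog hslit
    convert hd using 1
    have h1 := hzp z hz
    have h2 := hzq z hz
    field_simp
    ring

/-- A contour to the left of `p` does not wind around `p`: `log (p - z)` is a primitive, as the
slit plane contains the nonzero numbers of nonnegative real part. -/
theorem windingNumber_eq_zero_of_re_le (c : ClosedContour) {p : ℂ} (hp : p ∉ c.trace)
    (h : ∀ z ∈ c.trace, z.re ≤ p.re) : c.windingNumber p = 0 := by
  unfold windingNumber
  rw [c.integral_eq_zero_of_hasDerivAt (F := fun z => Complex.log (p - z)) (fun z hz => ?_)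
    (c.continuousOn_inv_sub hp), mul_zero]
  have hzp : z ≠ p := fun h => hp (h ▸ hz)
  have hslit : p - z ∈ Complex.slitPlane := by
    rw [Complex.mem_slitPlane_iff]
    rcases (h z hz).lt_or_eq with hlt | heq
    · exact Or.inl (by simpa using hlt)
    · refine Or.inr fun him => hzp (Complex.ext heq ?_)
      rw [Complex.sub_im] at him
      linarith
  have hd := ((hasDerivAt_id' z).const_sub p).clog hslit
  convert hd using 1
  rw [neg_div, one_div, ← inv_neg, neg_sub]

theorem windingNumber_eqOn (c : ClosedContour) {S : Set ℂ} (hS : IsPreconnected S)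
    (hdisj : ∀ p ∈ S, p ∉ c.trace) {p q : ℂ} (hp : p ∈ S) (hq : q ∈ S) :
    c.windingNumber p = c.windingNumber q := by
  refine hS.induction₂ (fun a b => c.windingNumber a = c.windingNumber b) (fun a ha => ?_)
    (fun _ _ _ _ _ _ h₁ h₂ => h₁.trans h₂) (fun _ _ _ _ h => h.symm) hp hq
  obtain ⟨ε, hε, h⟩ := c.exists_windingNumber_eq (hdisj a ha)
  filter_upwards [mem_nhdsWithin_of_mem_nhds (Metric.ball_mem_nhds a hε)] with b hb
  exact (h b hb).symm

/-- If `γ` contains `Γ` in its interior, then `γ` lies in the exterior of `Γ`. The point of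
`Γ ∪ γ` of largest real part has winding number `0` with respect to the contour it is not on, so it
lies on `γ`; and the winding number of `Γ` is constant along `γ`. -/
theorem excludes_of_encloses (Γ γ : ClosedContour) (h : ∀ z ∈ Γ.trace, γ.Encloses z) {w : ℂ}
    (hw : w ∈ γ.trace) : Γ.Excludes w := by
  have hdisj : ∀ p ∈ γ.trace, p ∉ Γ.trace := fun p hp hp' => (h p hp').1 hp
  refine ⟨hdisj w hw, ?_⟩
  obtain ⟨p, hp, hmax⟩ := (Γ.isCompact_trace.union γ.isCompact_trace).exists_isMaxOn
    (Γ.trace_nonempty.mono subset_union_left) Complex.continuous_re.continuousOn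
  rcases hp with hp | hp
  · have h0 := γ.windingNumber_eq_zero_of_re_le (h p hp).1 fun z hz => hmax (Or.inr hz)
    exact absurd ((h p hp).2.symm.trans h0) one_ne_zero
  · rw [Γ.windingNumber_eqOn γ.isPreconnected_trace hdisj hw hp]
    exact Γ.windingNumber_eq_zero_of_re_le (hdisj p hp) fun z hz => hmax (Or.inl hz)

theorem integral_eval (c : ClosedContour) (P : Polynomial ℂ) :
    c.integral (fun z => P.eval z) = 0 := by
  obtain ⟨Q, hQ⟩ : ∃ Q : Polynomial ℂ, Q.derivative = P := by
    induction P using Polynomial.induction_on' with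
    | add p q hp hq =>
      obtain ⟨p', rfl⟩ := hp
      obtain ⟨q', rfl⟩ := hq
      exact ⟨p' + q', Polynomial.derivative_add⟩
    | monomial k a =>
      refine ⟨Polynomial.monomial (k + 1) (a / ((k + 1 : ℕ) : ℂ)), ?_⟩
      rw [Polynomial.derivative_monomial, div_mul_cancel₀ _ (Nat.cast_ne_zero.2 k.succ_ne_zero),
        Nat.add_sub_cancel]
  refine c.integral_eq_zero_of_hasDerivAt (F := fun z => Q.eval z) (fun z _ => ?_)
    P.continuous.continuousOn
  rw [← hQ]
  exact Q.hasDerivAt z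

/-- The residue theorem for a rational function with simple poles. -/
theorem integral_eval_div_prod (c : ClosedContour) {ι : Type*} [DecidableEq ι] (s : Finset ι)
    (a : ι → ℂ) (ha : Set.InjOn a s) (hs : ∀ i ∈ s, a i ∉ c.trace) (P : Polynomial ℂ) :
    c.integral (fun z => P.eval z / ∏ i ∈ s, (z - a i)) =
      2 * Real.pi * Complex.I * ∑ i ∈ s, c.windingNumber (a i) *
        (P.eval (a i) / ∏ j ∈ s.erase i, (a i - a j)) := by
  set N := Lagrange.nodal s a with hN
  have hmonic : N.Monic := Lagrange.nodal_monic
  have hmod : P %ₘ N = Lagrange.interpolate s a fun i => P.eval (a i) := by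
    refine Lagrange.eq_interpolate_of_eval_eq _ ha ?_ fun i hi => ?_
    · rw [← Lagrange.degree_nodal (v := a)]
      exact Polynomial.degree_modByMonic_lt _ hmonic
    · conv_rhs => rw [← Polynomial.modByMonic_add_div P N]
      rw [Polynomial.eval_add, Polynomial.eval_mul, hN, Lagrange.eval_nodal_at_node hi, zero_mul,
        add_zero]
  have hpf : ∀ z ∈ c.trace, P.eval z / ∏ i ∈ s, (z - a i) =
      (P /ₘ N).eval z +
        ∑ i ∈ s, Lagrange.nodalWeight s a i * P.eval (a i) * (z - a i)⁻¹ := by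
    intro z hz
    have hza : ∀ i ∈ s, z ≠ a i := fun i hi h => hs i hi (h ▸ hz)
    have hne : N.eval z ≠ 0 := Lagrange.eval_nodal_not_at_node hza
    have hev := Lagrange.eval_interpolate_not_at_node (fun i => P.eval (a i)) hza
    rw [← hmod, ← hN] at hev
    rw [← Lagrange.eval_nodal, ← hN, div_eq_iff hne]
    conv_lhs => rw [← Polynomial.modByMonic_add_div P N]
    rw [Polynomial.eval_add, Polynomial.eval_mul, hev, add_comm, add_mul, mul_comm (N.eval z),
      mul_comm (N.eval z)]
    congr 2
    exact Finset.sum_congr rfl fun i _ => by ring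
  have hterm : ∀ i ∈ s, ContinuousOn
      (fun z : ℂ => Lagrange.nodalWeight s a i * P.eval (a i) * (z - a i)⁻¹) c.trace :=
    fun i hi => continuousOn_const.mul (c.continuousOn_inv_sub (hs i hi))
  rw [c.integral_congr hpf, c.integral_add (P /ₘ N).continuous.continuousOn
    (continuousOn_finsetSum _ hterm), c.integral_eval, zero_add, c.integral_finsetSum s hterm,
    Finset.mul_sum]
  refine Finset.sum_congr rfl fun i _ => ?_
  rw [c.integral_const_mul, c.integral_inv_sub, Lagrange.nodalWeight, Finset.prod_inv_distrib]
  ring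

end ClosedContour

/-! ### Fredholm expansion of a finite determinant -/

/-- A tuple with a repeated entry contributes `0`, and every `k`-element set is the image of `k!`
injective tuples. -/
theorem Matrix.sum_det_submatrix_eq_factorial_mul_sum_minors {S R : Type*} [Fintype S]
    [DecidableEq S] [CommRing R] (M : Matrix S S R) (k : ℕ) :
    ∑ a : Fin k → S, (M.submatrix a a).det =
      (k.factorial : R) * ∑ s ∈ Finset.univ.powersetCard k,
        (M.submatrix (Subtype.val : s → S) (Subtype.val : s → S)).det := by
  classical
  have hinj : ∑ a : Fin k → S, (M.submatrix a a).det =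
      ∑ a ∈ Finset.univ.filter (fun a : Fin k → S => Function.Injective a),
        (M.submatrix a a).det := by
    refine (Finset.sum_filter_of_ne fun a _ hne => ?_).symm
    by_contra hni
    simp only [Function.Injective, not_forall] at hni
    obtain ⟨i, j, hij, hne'⟩ := hni
    exact hne (Matrix.det_zero_of_row_eq hne' (by ext l; simp [Matrix.submatrix_apply, hij]))
  have hmaps : ∀ a ∈ Finset.univ.filter (fun a : Fin k → S => Function.Injective a),
      Finset.univ.image a ∈ Finset.univ.powersetCard k := by
    intro a ha
    rw [Finset.mem_powersetCard]
    exact ⟨Finset.subset_univ _, by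
      rw [Finset.card_image_of_injective _ (Finset.mem_filter.1 ha).2, Finset.card_fin]⟩
  rw [hinj, ← Finset.sum_fiberwise_of_maps_to hmaps, Finset.mul_sum]
  refine Finset.sum_congr rfl fun s hs => ?_
  have hcard : s.card = k := (Finset.mem_powersetCard.1 hs).2
  have hsum : ∑ e : Fin k ≃ s, (M.submatrix (Subtype.val : s → S) Subtype.val).det =
      ∑ a ∈ (Finset.univ.filter (fun a : Fin k → S => Function.Injective a)).filter
        (fun a => Finset.univ.image a = s), (M.submatrix a a).det := by
    refine Finset.sum_bij (fun e _ i => (e i : S)) ?_ ?_ ?_ ?_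
    · intro e _
      simp only [Finset.mem_filter, Finset.mem_univ, true_and]
      refine ⟨Subtype.val_injective.comp e.injective, ?_⟩
      ext x
      simp only [Finset.mem_image, Finset.mem_univ, true_and]
      exact ⟨fun ⟨i, hi⟩ => hi ▸ (e i).2, fun hx => ⟨e.symm ⟨x, hx⟩, by simp⟩⟩
    · intro e _ e' _ h
      ext i
      exact congrFun h i
    · intro a ha
      simp only [Finset.mem_filter, Finset.mem_univ, true_and] at ha
      obtain ⟨hai, has⟩ := ha
      have hmem : ∀ i, a i ∈ s := fun i => has ▸ Finset.mem_image_of_mem a (Finset.mem_univ i)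
      refine ⟨Equiv.ofBijective (fun i => ⟨a i, hmem i⟩) ⟨fun i j h => hai (congrArg Subtype.val h),
        fun x => ?_⟩, Finset.mem_univ _, rfl⟩
      obtain ⟨i, -, hi⟩ := Finset.mem_image.1 (has.symm ▸ x.2 : (x : S) ∈ Finset.univ.image a)
      exact ⟨i, Subtype.ext hi⟩
    · intro e _
      rw [← Matrix.det_submatrix_equiv_self e, Matrix.submatrix_submatrix]
      rfl
  rw [← hsum, Finset.sum_const, Finset.card_univ, nsmul_eq_mul,
    Fintype.card_equiv (Fintype.equivOfCardEq (by simp [hcard]) : Fin k ≃ s), Fintype.card_fin]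

/-- The Fredholm expansion `det (1 + M) = ∑ₖ 1/k! ∑ det (M (aᵢ, aⱼ))` over the `k`-tuples `a`; the
terms with `k > card S` vanish. -/
theorem Matrix.hasSum_fredholm {S : Type*} [Fintype S] [DecidableEq S] (M : Matrix S S ℂ) :
    HasSum (fun k : ℕ => (k.factorial : ℂ)⁻¹ * ∑ a : Fin k → S, (M.submatrix a a).det)
      (1 + M).det := by
  have hcoeff : ∀ k : ℕ, (k.factorial : ℂ)⁻¹ * ∑ a : Fin k → S, (M.submatrix a a).det =
      (Matrix.det (1 + (Polynomial.X : Polynomial ℂ) • M.map Polynomial.C)).coeff k := by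
    intro k
    rw [Matrix.sum_det_submatrix_eq_factorial_mul_sum_minors,
      Matrix.coeff_det_one_add_X_smul_eq_sum_minors, ← mul_assoc,
      inv_mul_cancel₀ (Nat.cast_ne_zero.2 k.factorial_ne_zero), one_mul]
  simp only [hcoeff]
  set D := Matrix.det (1 + (Polynomial.X : Polynomial ℂ) • M.map Polynomial.C) with hD
  have heval : (1 + M).det = ∑ k ∈ Finset.range (D.natDegree + 1), D.coeff k := by
    have h : D.eval 1 = (1 + M).det := by
      rw [hD, ← Polynomial.coe_evalRingHom, RingHom.map_det]
      congr 1
      ext i j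
      simp [Matrix.one_apply, apply_ite]
    rw [← h, Polynomial.eval_eq_sum_range]
    simp
  rw [heval]
  refine hasSum_sum_of_ne_finset_zero fun k hk => ?_
  exact Polynomial.coeff_eq_zero_of_natDegree_lt (by simpa using hk)

/-! ### Determinantal processes on countable spaces -/

theorem integrable_pi_count_of_forall_mem {X : Type*} [MeasurableSpace X] [Countable X]
    [MeasurableSingletonClass X] {k : ℕ} (S : Finset X) (f : (Fin k → X) → ℂ)
    (hf : ∀ a, f a ≠ 0 → ∀ j, a j ∈ S) :
    Integrable f (Measure.pi fun _ : Fin k => (Measure.count : Measure X)) ∧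
      ∫ a, f a ∂(Measure.pi fun _ : Fin k => (Measure.count : Measure X)) =
        ∑ a : Fin k → S, f fun j => a j := by
  classical
  set μ := Measure.pi fun _ : Fin k => (Measure.count : Measure X) with hμ
  have hone : ∀ a, μ {a} = 1 := fun a => by simp [hμ, Measure.pi_singleton]
  set T : Finset (Fin k → X) := Finset.univ.image fun (a : Fin k → S) j => (a j : X) with hT
  have hsupp : ∀ a, a ∉ (T : Set (Fin k → X)) → f a = 0 := by
    intro a ha
    by_contra hne
    refine ha ?_
    simp only [hT, Finset.coe_image, Finset.coe_univ, image_univ, mem_range]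
    exact ⟨fun j => ⟨a j, hf a hne j⟩, rfl⟩
  have hfin : IsFiniteMeasure (μ.restrict (T : Set (Fin k → X))) := by
    refine ⟨?_⟩
    rw [Measure.restrict_apply_univ, ← sum_measure_singleton]
    simp [hone]
  have hint : Integrable f (μ.restrict (T : Set (Fin k → X))) := by
    have := IntegrableOn.finset (μ := μ.restrict (T : Set (Fin k → X))) (s := T) (f := f)
    rwa [IntegrableOn, Measure.restrict_restrict T.measurableSet, inter_self] at this
  refine ⟨(integrableOn_iff_integrable_of_support_subset fun a ha => ?_).1 hint, ?_⟩
  · by_contra hn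
    exact ha (hsupp a hn)
  · rw [← setIntegral_eq_integral_of_forall_compl_eq_zero hsupp, setIntegral_finset _ hint, hT,
      Finset.sum_image]
    · refine Finset.sum_congr rfl fun a _ => ?_
      rw [measureReal_def, hone]
      simp
    · intro a _ b _ h
      ext j
      exact congrFun h j

/-- On a countable space whose bounded sets are finite, a process is determinantal as soon as
`E[∏ᵢ (1 - φ(xᵢ))]` is the finite Fredholm determinant `det (1 - φ K)`. -/
theorem isDeterminantal_of_integral_eq_det {X : Type*} [MetricSpace X] [MeasurableSpace X]
    [Countable X] [MeasurableSingletonClass X]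
    (hX : ∀ B : Set X, Bornology.IsBounded B → B.Finite)
    (P : Measure (PointConfig X)) (hP : IsProbabilityMeasure P) (K : X → X → ℂ)
    (h : ∀ (φ : X → ℂ) (S₀ : Finset X), Function.support φ ⊆ S₀ →
      Integrable (fun ξ : PointConfig X => ξ.prodOneSub φ) P ∧
      ∃ S : Finset X, Function.support φ ⊆ S ∧
        ∀ _ : DecidableEq S, ∫ ξ : PointConfig X, ξ.prodOneSub φ ∂P =
          (1 - Matrix.of fun p q : S => φ p * K p q).det) :
    IsDeterminantal P Measure.count K := by
  classical
  have : DiscreteMeasurableSpace X := MeasurableSingletonClass.toDiscreteMeasurableSpace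
  refine ⟨hP, Measurable.of_discrete, fun k => Measurable.of_discrete, fun a => ?_,
    fun φ _ _ hφ => ?_⟩
  · simp
  obtain ⟨hint, S, hS, hdet⟩ := h φ (hX _ hφ).toFinset (by simp)
  have hpi := fun k : ℕ => integrable_pi_count_of_forall_mem (k := k) S
    (fun a => (∏ j, φ (a j)) * (Matrix.of fun i j : Fin k => K (a i) (a j)).det) (by
      intro a ha j
      exact hS (Finset.prod_ne_zero_iff.1 (left_ne_zero_of_mul ha) j (Finset.mem_univ j)))
  refine ⟨hint, fun k => (hpi k).1, ?_⟩
  rw [hdet inferInstance, sub_eq_add_neg]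
  convert Matrix.hasSum_fredholm (-(Matrix.of fun p q : S => φ p * K p q)) using 2 with k
  rw [(hpi k).2, Finset.mul_sum, Finset.mul_sum]
  refine Finset.sum_congr rfl fun a _ => ?_
  have hsub : (-(Matrix.of fun p q : S => φ p * K p q)).submatrix a a =
      -(Matrix.of fun i j : Fin k => φ (a i) * (Matrix.of fun i j : Fin k => K (a i) (a j)) i j) := by
    ext i j
    simp
  rw [hsub, Matrix.det_neg, Matrix.det_mul_column, Fintype.card_fin]
  ring

/-! ### Weighted sums over interlacing patterns -/

/-- The solution of the difference equations `f (s + 1) v - f (s + 1) (v - 1) = g s v * f s v`,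
`v > A`, with `f 0 = 0` and the values `f (s + 1) A = c s` at the base point `A`. -/
noncomputable def evolve (A : ℤ) (g : ℕ → ℤ → ℂ) (c : ℕ → ℂ) : ℕ → ℤ → ℂ
  | 0, _ => 0
  | s + 1, v => c s + ∑ u ∈ Finset.Ioc A v, g s u * evolve A g c s u

theorem evolve_eq_zero {A : ℤ} {g : ℕ → ℤ → ℂ} {c : ℕ → ℂ} {s : ℕ} (hc : ∀ k < s, c k = 0)
    (v : ℤ) : evolve A g c s v = 0 := by
  induction s generalizing v with
  | zero => rfl
  | succ s ih =>
    simp only [evolve, hc s s.lt_succ_self, ih fun k hk => hc k (hk.trans s.lt_succ_self),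
      mul_zero, Finset.sum_const_zero, add_zero]

theorem evolve_eq_sum_single (A : ℤ) (g : ℕ → ℤ → ℂ) (c : ℕ → ℂ) (n s : ℕ) (hs : s ≤ n) (v : ℤ) :
    evolve A g c s v = ∑ a : Fin n, c a * evolve A g (Pi.single (a : ℕ) 1) s v := by
  induction s generalizing v with
  | zero => simp [evolve]
  | succ s ih =>
    have hc : c s = ∑ a : Fin n, c a * (Pi.single (a : ℕ) 1 : ℕ → ℂ) s := by
      rw [Finset.sum_eq_single (⟨s, hs⟩ : Fin n)]
      · simp
      · intro a _ ha
        rw [Pi.single_eq_of_ne (fun h => ha (Fin.ext h.symm)), mul_zero]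
      · simp
    simp only [evolve, mul_add, Finset.sum_add_distrib, ← hc, Finset.mul_sum]
    rw [Finset.sum_comm]
    congr 1
    refine Finset.sum_congr rfl fun u _ => ?_
    rw [ih (by omega), Finset.mul_sum]
    exact Finset.sum_congr rfl fun a _ => by ring

theorem evolve_sub_evolve {A : ℤ} (g : ℕ → ℤ → ℂ) (c : ℕ → ℂ) (s : ℕ) {v w : ℤ} (hv : A ≤ v)
    (hvw : v ≤ w) : evolve A g c (s + 1) w - evolve A g c (s + 1) v =
      ∑ u ∈ Finset.Ioc v w, g s u * evolve A g c s u := by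
  have hu : Finset.Ioc A w = Finset.Ioc A v ∪ Finset.Ioc v w :=
    (Finset.Ioc_union_Ioc_eq_Ioc hv hvw).symm
  have hd : Disjoint (Finset.Ioc A v) (Finset.Ioc v w) := by
    rw [Finset.disjoint_left]
    intro u h₁ h₂
    rw [Finset.mem_Ioc] at h₁ h₂
    omega
  simp only [evolve, hu, Finset.sum_union hd]
  ring

theorem Matrix.det_of_last_row_eq_one {R : Type*} [CommRing R] {n : ℕ}
    (M : Matrix (Fin (n + 1)) (Fin (n + 1)) R) (hM : ∀ j, M (Fin.last n) j = 1) :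
    M.det = (Matrix.of fun i j : Fin n =>
      M i.castSucc j.castSucc - M i.castSucc j.succ).det := by
  set B : Matrix (Fin (n + 1)) (Fin (n + 1)) R := Matrix.of fun i j =>
    Fin.cases (M i 0) (fun k => M i k.succ - M i k.castSucc) j with hB
  have hMB : M.det = B.det := by
    refine Matrix.det_eq_of_forall_col_eq_smul_add_pred (fun _ => 1) (fun i => ?_) fun i j => ?_
    · simp [hB]
    · simp [hB]
  have hsub : B.submatrix (Fin.last n).succAbove (Fin.succAbove 0) =
      -(Matrix.of fun i j : Fin n => M i.castSucc j.castSucc - M i.castSucc j.succ) := by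
    ext i j
    simp [hB]
  rw [hMB, Matrix.det_succ_row B (Fin.last n), Fin.sum_univ_succ, hsub, Matrix.det_neg]
  have h0 : ∀ j : Fin n, B (Fin.last n) j.succ = 0 := fun j => by simp [hB, hM]
  have h1 : B (Fin.last n) 0 = 1 := by simp [hB, hM]
  simp only [h0, h1, mul_zero, zero_mul, Finset.sum_const_zero, add_zero, mul_one, Fin.val_last,
    Fin.val_zero, Fintype.card_fin]
  rw [← mul_assoc, ← mul_pow]
  simp

theorem Matrix.sum_piFinset_prod_mul_det {n : ℕ} (I : Fin n → Finset ℤ) (w : ℤ → ℂ)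
    (f : Fin n → ℤ → ℂ) :
    ∑ y ∈ Fintype.piFinset I, (∏ i, w (y i)) * (Matrix.of fun a b : Fin n => f a (y b)).det =
      (Matrix.of fun a b : Fin n => ∑ u ∈ I b, w u * f a u).det := by
  have h := (Matrix.detRowAlternating (n := Fin n) (R := ℂ)).toMultilinearMap.map_sum_finset
    (fun (b : Fin n) (u : ℤ) (a : Fin n) => w u * f a u) I
  rw [← Matrix.det_transpose (Matrix.of fun a b : Fin n => ∑ u ∈ I b, w u * f a u)]
  refine Eq.trans ?_ (h.symm.trans ?_)
  · refine Finset.sum_congr rfl fun y _ => ?_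
    rw [← Matrix.det_transpose, ← Matrix.det_mul_column]
    rfl
  · change Matrix.det _ = Matrix.det _
    congr 1
    ext b a
    simp [Finset.sum_apply]

/-- The product of the weights `g r` over the particles of the rows below the top row. -/
noncomputable def patternWeight {n : ℕ} (g : ℕ → ℤ → ℂ) (y : TriangularArray n) : ℂ :=
  ∏ r : Fin n, ∏ i : Fin r, g r (y r.castSucc i)

theorem mem_gtPatterns_succ {n : ℕ} (x : Fin (n + 1) → ℤ) (y : TriangularArray (n + 1)) :
    y ∈ gtPatterns x ↔ y (Fin.last (n + 1)) = x ∧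
      (∀ i : Fin n, x i.succ < y (Fin.last n).castSucc i ∧
        y (Fin.last n).castSucc i ≤ x i.castSucc) ∧
      (Fin.init y : TriangularArray n) ∈ gtPatterns (y (Fin.last n).castSucc) := by
  constructor
  · rintro ⟨h, htop⟩
    have hx : y (Fin.last (n + 1)) = x := funext htop
    refine ⟨hx, fun i => ?_, fun r hr i hi => h r (by omega) i hi, fun i => rfl⟩
    subst hx
    exact (h n (by omega) i i.2).symm
  · rintro ⟨rfl, hn, h, -⟩
    refine ⟨fun r hr i hi => ?_, fun i => rfl⟩
    rcases (Nat.lt_succ_iff.1 hr).lt_or_eq with hr' | rfl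
    · exact h r hr' i hi
    · exact (hn ⟨i, hi⟩).symm

/-- The weighted number of interlacing patterns is a determinant. The row below the
top row `x` ranges over a product of intervals `(x (b + 1), x b]`, so by multilinearity the sum over
it of `∏ g * det (f a (y b))` is `det (F a (x b) - F a (x (b + 1)))` for antidifferences `F a` of
`g * f a`. Column differences identify this with the determinant that has an additional row of
ones, which is the new solution supported on the top row. -/
theorem exists_finset_gtPatterns {A : ℤ} (g : ℕ → ℤ → ℂ) {n : ℕ} (x : Fin n → ℤ)
    (hx : StrictAnti x) (hA : ∀ i, A ≤ x i) :
    ∃ T : Finset (TriangularArray n), (T : Set (TriangularArray n)) = gtPatterns x ∧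
      ∑ y ∈ T, patternWeight g y =
        (Matrix.of fun a b : Fin n => evolve A g (Pi.single (a : ℕ) 1) n (x b)).det := by
  classical
  induction n with
  | zero =>
    refine ⟨{fun r i => absurd i.2 (by omega)}, ?_, ?_⟩
    · ext y
      simp only [Finset.coe_singleton, mem_singleton_iff]
      constructor
      · rintro -
        exact ⟨fun r hr => absurd hr (Nat.not_lt_zero r), fun i => i.elim0⟩
      · intro _
        ext r i
        exact absurd i.2 (by omega)
    · simp [patternWeight]
  | succ n ih =>
    set I : Fin n → Finset ℤ := fun i => Finset.Ioc (x i.succ) (x i.castSucc) with hI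
    have hanti : ∀ y ∈ Fintype.piFinset I, StrictAnti y := by
      intro y hy i j hij
      have h₁ := Finset.mem_Ioc.1 (Fintype.mem_piFinset.1 hy i)
      have h₂ := Finset.mem_Ioc.1 (Fintype.mem_piFinset.1 hy j)
      have h₃ : x j.castSucc ≤ x i.succ := hx.antitone (by
        rw [Fin.le_def]
        simp only [Fin.val_succ, Fin.val_castSucc]
        exact hij)
      omega
    have hAy : ∀ y ∈ Fintype.piFinset I, ∀ i, A ≤ y i := by
      intro y hy i
      have h₁ := Finset.mem_Ioc.1 (Fintype.mem_piFinset.1 hy i)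
      have := hA i.succ
      omega
    choose! T hT hsum using fun y (hy : y ∈ Fintype.piFinset I) => ih y (hanti y hy) (hAy y hy)
    set ext : TriangularArray n → TriangularArray (n + 1) :=
      fun Y => Fin.snoc (α := fun r : Fin (n + 2) => Fin r → ℤ) Y x with hext
    have hinit : ∀ Y, (Fin.init (ext Y) : TriangularArray n) = Y := fun Y =>
      Fin.init_snoc (α := fun r : Fin (n + 2) => Fin r → ℤ) _ _
    have hlast : ∀ Y, ext Y (Fin.last (n + 1)) = x := fun Y =>
      Fin.snoc_last (α := fun r : Fin (n + 2) => Fin r → ℤ) _ _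
    have hcast : ∀ Y (r : Fin (n + 1)), ext Y r.castSucc = Y r := fun Y r =>
      Fin.snoc_castSucc (α := fun r : Fin (n + 2) => Fin r → ℤ) _ _ _
    have htop : ∀ y ∈ Fintype.piFinset I, ∀ Y ∈ T y, Y (Fin.last n) = y := by
      intro y hy Y hY
      have hY' : Y ∈ gtPatterns y := by
        rw [← hT y hy]
        exact hY
      exact funext hY'.2
    have hinj : Function.Injective ext := fun Y Y' h => by rw [← hinit Y, h, hinit]
    refine ⟨(Fintype.piFinset I).biUnion fun y => (T y).image ext, ?_, ?_⟩
    · ext Y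
      rw [mem_gtPatterns_succ]
      simp only [Finset.coe_biUnion, Finset.coe_image, mem_iUnion, Set.mem_image, Finset.mem_coe,
        exists_prop]
      constructor
      · rintro ⟨y, hy, Y', hY', rfl⟩
        rw [hlast, hinit, hcast, htop y hy Y' hY', ← hT y hy]
        exact ⟨rfl, fun i => Finset.mem_Ioc.1 (Fintype.mem_piFinset.1 hy i), hY'⟩
      · rintro ⟨hl, hi, hY⟩
        have hy : Y (Fin.last n).castSucc ∈ Fintype.piFinset I :=
          Fintype.mem_piFinset.2 fun i => Finset.mem_Ioc.2 (hi i)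
        refine ⟨_, hy, Fin.init Y, ?_, ?_⟩
        · rw [← hT _ hy] at hY
          exact hY
        · rw [hext, ← hl]
          exact Fin.snoc_init_self (α := fun r : Fin (n + 2) => Fin r → ℤ) Y
    · rw [Finset.sum_biUnion]
      · have hw : ∀ y ∈ Fintype.piFinset I, ∑ Y ∈ (T y).image ext, patternWeight g Y =
            (∏ i, g n (y i)) *
              (Matrix.of fun a b : Fin n => evolve A g (Pi.single (a : ℕ) 1) n (y b)).det := by
          intro y hy
          rw [Finset.sum_image fun _ _ _ _ h => hinj h, ← hsum y hy, Finset.mul_sum]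
          refine Finset.sum_congr rfl fun Y hY => ?_
          unfold patternWeight
          rw [Fin.prod_univ_castSucc, mul_comm]
          congr 1
          · simp only [hcast, htop y hy Y hY]
            rfl
          · simp only [hcast]
            rfl
        rw [Finset.sum_congr rfl hw, Matrix.sum_piFinset_prod_mul_det I (g n)
          fun a => evolve A g (Pi.single (a : ℕ) 1) n, Matrix.det_of_last_row_eq_one (n := n)]
        · congr 1
          ext a b
          simp only [Matrix.of_apply, Fin.val_castSucc]
          rw [evolve_sub_evolve _ _ _ (hA _) (hx.antitone b.castSucc_lt_succ.le)]
        · intro b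
          simp only [Matrix.of_apply, Fin.val_last, evolve, Pi.single_eq_same]
          rw [Finset.sum_eq_zero, add_zero]
          intro u _
          rw [evolve_eq_zero fun k hk => Pi.single_eq_of_ne hk.ne _, mul_zero]
      · intro y hy y' hy' hne
        rw [Function.onFun, Finset.disjoint_left]
        intro Y hY hY'
        obtain ⟨Z, hZ, rfl⟩ := Finset.mem_image.1 hY
        obtain ⟨Z', hZ', h⟩ := Finset.mem_image.1 hY'
        obtain rfl := hinj h
        exact hne ((htop y hy _ hZ).symm.trans (htop y' hy' _ hZ'))

/-! ### The Green's function and the Fredholm determinant -/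

/-- The `m`-fold convolution power of `1_{u ≤ v}`, that is `1_{u ≤ v} (v - u + 1)_{m-1} / (m-1)!`;
it is `0` for `m = 0`. -/
noncomputable def rowTransition (m : ℕ) (u v : ℤ) : ℂ :=
  if 0 < m ∧ u ≤ v then
    (ascPochhammer ℂ (m - 1)).eval ((v : ℂ) - u + 1) / ((m - 1).factorial : ℂ)
  else 0

theorem rowTransition_zero (u v : ℤ) : rowTransition 0 u v = 0 := by simp [rowTransition]

theorem rowTransition_one (u v : ℤ) : rowTransition 1 u v = if u ≤ v then 1 else 0 := by
  simp [rowTransition]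

theorem rowTransition_of_lt {u v : ℤ} (h : v < u) (m : ℕ) : rowTransition m u v = 0 := by
  simp [rowTransition, h]

theorem rowTransition_succ_sub (m : ℕ) (hm : 0 < m) (u v : ℤ) :
    rowTransition (m + 1) u v - rowTransition (m + 1) u (v - 1) = rowTransition m u v := by
  obtain ⟨m, rfl⟩ : ∃ k, m = k + 1 := ⟨m - 1, by omega⟩
  have hf : ((m + 1).factorial : ℂ) = (m + 1) * m.factorial := by
    rw [Nat.factorial_succ]; push_cast; ring
  have hm0 : (m : ℂ) + 1 ≠ 0 := by exact_mod_cast m.succ_ne_zero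
  have hf0 : (m.factorial : ℂ) ≠ 0 := Nat.cast_ne_zero.2 m.factorial_ne_zero
  have hup : ∀ a : ℂ, (ascPochhammer ℂ (m + 1)).eval (a + 1) =
      (a + 1 + m) * (ascPochhammer ℂ m).eval (a + 1) := fun a => by
    rw [ascPochhammer_succ_eval, mul_comm]
  have hlo : ∀ a : ℂ, (ascPochhammer ℂ (m + 1)).eval a =
      a * (ascPochhammer ℂ m).eval (a + 1) := fun a => by
    rw [ascPochhammer_succ_left]
    simp [Polynomial.eval_comp]
  rcases lt_trichotomy v u with h | rfl | h
  · rw [rowTransition_of_lt h, rowTransition_of_lt h, rowTransition_of_lt (by omega), sub_zero]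
  · rw [rowTransition_of_lt (by omega : v - 1 < v)]
    simp only [rowTransition, Nat.add_sub_cancel, Nat.succ_pos, le_refl, and_self, if_true, hf,
      hup, sub_self]
    field_simp
    ring
  · have h1 : u ≤ v - 1 := by omega
    simp only [rowTransition, Nat.add_sub_cancel, Nat.succ_pos, h.le, h1, and_self, if_true, hf]
    have h2 : ((v - 1 : ℤ) : ℂ) - u + 1 = (v : ℂ) - u := by push_cast; ring
    rw [h2, hlo ((v : ℂ) - u), hup ((v : ℂ) - u)]
    field_simp
    ring

theorem sum_Ioc_eq_sub (f F : ℤ → ℂ) {A : ℤ} (h : ∀ v, A < v → F v - F (v - 1) = f v) {v : ℤ}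
    (hv : A ≤ v) : ∑ u ∈ Finset.Ioc A v, f u = F v - F A := by
  induction v, hv using Int.leInduction with
  | base => simp
  | succ v hv ih =>
    have : Finset.Ioc A (v + 1) = insert (v + 1) (Finset.Ioc A v) := by
      ext u
      simp only [Finset.mem_Ioc, Finset.mem_insert]
      omega
    rw [this, Finset.sum_insert (by simp), ih, ← h (v + 1) (by omega), add_sub_cancel_right]
    ring

theorem sum_rowTransition {A : ℤ} (m : ℕ) (hm : 0 < m) {u v : ℤ} (hu : A < u) (hv : A ≤ v) :
    ∑ t ∈ Finset.Ioc A v, rowTransition m u t = rowTransition (m + 1) u v := by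
  rw [sum_Ioc_eq_sub _ (rowTransition (m + 1) u) (fun t _ => rowTransition_succ_sub m hm u t) hv,
    rowTransition_of_lt hu, sub_zero]

/-- Duhamel's formula: perturbing the coefficients of the difference equation from `1` to `1 - φ`
changes the solution by the response to the source `-φ f`. -/
theorem evolve_one_sub_eq {A B : ℤ} (φ : ℕ → ℤ → ℂ) (c : ℕ → ℂ) (s : ℕ) {v : ℤ} (hA : A ≤ v)
    (hB : v ≤ B) :
    evolve A (fun r u => 1 - φ r u) c s v = evolve A (fun _ _ => 1) c s v -
      ∑ r ∈ Finset.range s, ∑ u ∈ Finset.Ioc A B,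
        evolve A (fun r u => 1 - φ r u) c r u * φ r u * rowTransition (s - r) u v := by
  induction s generalizing v with
  | zero => simp [evolve]
  | succ s ih =>
    set f := evolve A (fun r u => 1 - φ r u) c with hf
    have hstep : f (s + 1) v = c s + ∑ t ∈ Finset.Ioc A v, f s t -
        ∑ t ∈ Finset.Ioc A v, f s t * φ s t := by
      rw [hf, evolve, add_sub_assoc, ← Finset.sum_sub_distrib]
      congr 1
      exact Finset.sum_congr rfl fun t _ => by ring
    have hlast : ∑ t ∈ Finset.Ioc A v, f s t * φ s t =
        ∑ u ∈ Finset.Ioc A B, f s u * φ s u * rowTransition (s + 1 - s) u v := by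
      rw [Nat.add_sub_cancel_left]
      simp only [rowTransition_one, mul_ite, mul_one, mul_zero]
      rw [← Finset.sum_filter]
      congr 1
      ext t
      simp only [Finset.mem_filter, Finset.mem_Ioc]
      omega
    have hsum : ∑ t ∈ Finset.Ioc A v, f s t =
        ∑ t ∈ Finset.Ioc A v, evolve A (fun _ _ => 1) c s t -
          ∑ r ∈ Finset.range s, ∑ u ∈ Finset.Ioc A B,
            f r u * φ r u * rowTransition (s + 1 - r) u v := by
      rw [Finset.sum_congr rfl fun t ht => ih (v := t) (Finset.mem_Ioc.1 ht).1.le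
        ((Finset.mem_Ioc.1 ht).2.trans hB), Finset.sum_sub_distrib, Finset.sum_comm]
      congr 1
      refine Finset.sum_congr rfl fun r hr => ?_
      rw [Finset.sum_comm]
      refine Finset.sum_congr rfl fun u hu => ?_
      have hr' := Finset.mem_range.1 hr
      rw [← Finset.mul_sum, sum_rowTransition _ (by omega) (Finset.mem_Ioc.1 hu).1 hA,
        show s - r + 1 = s + 1 - r by omega]
    rw [hstep, hsum, hlast, Finset.sum_range_succ]
    simp only [evolve, one_mul]
    ring

theorem evolve_one_eq {A : ℤ} (V : ℕ → ℤ → ℂ) (n : ℕ) (h0 : ∀ v, V 0 v = 0)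
    (hV : ∀ s < n, ∀ v, V (s + 1) v - V (s + 1) (v - 1) = V s v) (s : ℕ) (hs : s ≤ n) {v : ℤ}
    (hv : A ≤ v) : evolve A (fun _ _ => 1) (fun k => V (k + 1) A) s v = V s v := by
  induction s generalizing v with
  | zero => exact (h0 v).symm
  | succ s ih =>
    simp only [evolve, one_mul]
    rw [Finset.sum_congr rfl fun t ht => ih (by omega) (v := t) (Finset.mem_Ioc.1 ht).1.le,
      sum_Ioc_eq_sub _ (V (s + 1)) (fun t _ => hV s (by omega) t) hv]
    ring

/-- Extension by zero of a function on the sites to all pairs of a row and a position. -/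
noncomputable def extendSite {n : ℕ} (φ : Site n → ℂ) (r : ℕ) (u : ℤ) : ℂ :=
  if h : r ∈ Set.Ico 1 n then φ (⟨r, h⟩, u) else 0

theorem extendSite_coe {n : ℕ} (φ : Site n → ℂ) (p : Site n) : extendSite φ p.1 p.2 = φ p := by
  simp [extendSite, p.1.2]

theorem sum_sites {n : ℕ} {A B : ℤ} {S : Finset (Site n)}
    (hS : S = Finset.univ ×ˢ Finset.Ioc A B) (F : ℕ → ℤ → ℂ) (hF : ∀ u, F 0 u = 0) {s : ℕ}
    (hs : s ≤ n) (hFs : ∀ r, s ≤ r → ∀ u, F r u = 0) :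
    ∑ p : S, F p.1.1 p.1.2 = ∑ r ∈ Finset.range s, ∑ u ∈ Finset.Ioc A B, F r u := by
  subst hS
  rw [Finset.sum_coe_sort (Finset.univ ×ˢ Finset.Ioc A B : Finset (Site n)) fun p => F p.1 p.2,
    Finset.sum_product, ← Finset.sum_subtype (Finset.Ico 1 n) (p := (· ∈ Set.Ico 1 n)) (by simp)
      fun r => ∑ u ∈ Finset.Ioc A B, F r u,
    Finset.sum_subset (Finset.range_subset_range.2 hs : Finset.range s ⊆ Finset.range n)]
  · refine Finset.sum_subset (fun r hr => ?_) fun r hr hr' => Finset.sum_eq_zero fun u _ => ?_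
    · simp only [Finset.mem_Ico, Finset.mem_range] at hr ⊢
      omega
    · simp only [Finset.mem_Ico, Finset.mem_range] at hr hr'
      rw [show r = 0 by omega, hF]
  · intro r _ hr
    exact Finset.sum_eq_zero fun u _ => hFs r (by simpa using hr) u

/-- The Fredholm determinant of the kernel on a window of sites is the determinant of the perturbed
solutions at the top row. With `N`, `U`, `V` the matrices of `φ · rowTransition`, of the responses
at the points `x` and of the unperturbed solutions, Duhamel's formula reads `V = R (1 + N)`, so that
`1 - φ K = 1 + N - U V = (1 - U R) (1 + N)`, where `N` is strictly triangular in the rows. -/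
theorem det_one_sub_mul_kernel {n : ℕ} (x : Fin n → ℤ) {A B : ℤ} (hA : ∀ i, A ≤ x i)
    (hB : ∀ i, x i ≤ B) (φ : Site n → ℂ) (V : Fin n → ℕ → ℤ → ℂ) (h0 : ∀ j v, V j 0 v = 0)
    (hV : ∀ j, ∀ s < n, ∀ v, V j (s + 1) v - V j (s + 1) (v - 1) = V j s v)
    (hVx : ∀ j b, V j n (x b) = if j = b then 1 else 0)
    {S : Finset (Site n)} (hS : S = Finset.univ ×ˢ Finset.Ioc A B) [DecidableEq S] :
    (1 - Matrix.of fun p q : S =>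
      φ p * (-rowTransition (q.1.1 - p.1.1) p.1.2 q.1.2 +
        ∑ j, rowTransition (n - p.1.1) p.1.2 (x j) * V j q.1.1 q.1.2)).det =
    (Matrix.of fun j b : Fin n => evolve A (fun r u => 1 - extendSite φ r u)
      (fun k => V j (k + 1) A) n (x b)).det := by
  set R : Fin n → ℕ → ℤ → ℂ := fun j => evolve A (fun r u => 1 - extendSite φ r u)
      (fun k => V j (k + 1) A) with hR
  have hRj : ∀ j, evolve A (fun r u => 1 - extendSite φ r u) (fun k => V j (k + 1) A) = R j :=
    fun _ => rfl
  have hduh : ∀ j, ∀ s ≤ n, ∀ v, A ≤ v → v ≤ B →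
      R j s v = V j s v - ∑ p : S, R j p.1.1 p.1.2 * φ p.1 *
        rowTransition (s - p.1.1) p.1.2 v := by
    intro j s hs v hAv hBv
    have h := evolve_one_sub_eq (extendSite φ) (fun k => V j (k + 1) A) s hAv hBv
    rw [evolve_one_eq (V j) n (h0 j) (hV j) s hs hAv] at h
    rw [hRj] at h
    rw [h]
    congr 1
    rw [← sum_sites hS (fun r u => R j r u * extendSite φ r u * rowTransition (s - r) u v) ?_ hs ?_]
    · exact Finset.sum_congr rfl fun p _ => by rw [extendSite_coe]
    · intro u
      simp [hR, evolve]
    · intro r hr u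
      rw [Nat.sub_eq_zero_of_le hr, rowTransition_zero, mul_zero]
  set N : Matrix S S ℂ := Matrix.of fun p q =>
    φ p * rowTransition (q.1.1 - p.1.1) p.1.2 q.1.2 with hN
  set U : Matrix S (Fin n) ℂ := Matrix.of fun p j =>
    φ p * rowTransition (n - p.1.1) p.1.2 (x j) with hU
  set VM : Matrix (Fin n) S ℂ := Matrix.of fun j q => V j q.1.1 q.1.2 with hVM
  set RM : Matrix (Fin n) S ℂ := Matrix.of fun j q => R j q.1.1 q.1.2 with hRM
  have hVR : VM = RM * (1 + N) := by
    ext j q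
    have hq := Finset.mem_Ioc.1 (Finset.mem_product.1 (hS.le q.2)).2
    rw [Matrix.mul_add, Matrix.mul_one, Matrix.add_apply, Matrix.mul_apply]
    simp only [hVM, hRM, hN, Matrix.of_apply]
    rw [hduh j q.1.1 q.1.1.2.2.le q.1.2 hq.1.le hq.2]
    simp only [mul_assoc, sub_add_cancel]
  have hfac : (1 - Matrix.of fun p q : S =>
      φ p * (-rowTransition (q.1.1 - p.1.1) p.1.2 q.1.2 +
        ∑ j, rowTransition (n - p.1.1) p.1.2 (x j) * V j q.1.1 q.1.2)) =
      (1 - U * RM) * (1 + N) := by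
    rw [Matrix.sub_mul, Matrix.one_mul, Matrix.mul_assoc, ← hVR]
    ext p q
    simp only [Matrix.sub_apply, Matrix.add_apply, Matrix.mul_apply, Matrix.of_apply, hN, hU, hVM,
      mul_add, Finset.mul_sum, mul_assoc]
    ring
  have hdetN : (1 + N).det = 1 := by
    have htri : (1 + N).BlockTriangular fun p : S => (p.1.1 : ℕ) := by
      intro p q hpq
      simp only at hpq
      have hne : p ≠ q := fun h => by simp [h] at hpq
      simp only [Matrix.add_apply, Matrix.one_apply_ne hne, hN, Matrix.of_apply]
      rw [Nat.sub_eq_zero_of_le hpq.le, rowTransition_zero, mul_zero, add_zero]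
    rw [htri.det]
    refine Finset.prod_eq_one fun k _ => ?_
    have : (1 + N).toSquareBlock (fun p : S => (p.1.1 : ℕ)) k = 1 := by
      ext p q
      have hpq : (q.1.1.1 : ℕ) - (p.1.1.1 : ℕ) = 0 := by rw [p.2, q.2, Nat.sub_self]
      simp only [Matrix.toSquareBlock_def, Matrix.of_apply, Matrix.add_apply, hN]
      rw [hpq, rowTransition_zero, mul_zero, add_zero, Matrix.one_apply, Matrix.one_apply]
      simp only [Subtype.ext_iff]
    rw [this, Matrix.det_one]
  rw [hfac, Matrix.det_mul, hdetN, mul_one, Matrix.det_one_sub_mul_comm]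
  congr 1
  ext j b
  have h := hduh j n le_rfl (x b) (hA b) (hB b)
  simp only [Matrix.sub_apply, Matrix.mul_apply, Matrix.of_apply, Matrix.one_apply, hRM, hU, hRj]
  rw [h, hVx]
  simp only [mul_assoc]

/-! ### Evaluation of the kernel by residues -/

theorem prod_Icc_sub_eq_ascPochhammer (m : ℕ) (u : ℤ) (z : ℂ) :
    ∏ k ∈ Finset.Icc (u - m) (u - 1), (z - k) = (ascPochhammer ℂ m).eval (z - u + 1) := by
  induction m with
  | zero => simp
  | succ m ih =>
    have : Finset.Icc (u - ((m + 1 : ℕ) : ℤ)) (u - 1) =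
        insert (u - ((m + 1 : ℕ) : ℤ)) (Finset.Icc (u - m) (u - 1)) := by
      ext k
      simp only [Finset.mem_Icc, Finset.mem_insert]
      push_cast
      omega
    rw [this, Finset.prod_insert (by rw [Finset.mem_Icc]; push_cast; omega), ih,
      ascPochhammer_succ_eval]
    push_cast
    ring

theorem prod_range_erase_sub (i d : ℕ) :
    ∏ l ∈ (Finset.range (i + d + 1)).erase i, ((i : ℂ) - l) =
      i.factorial * ((-1) ^ d * d.factorial) := by
  have hlow : ∏ l ∈ Finset.range i, ((i : ℂ) - l) = i.factorial := by
    rw [← Finset.prod_range_reflect, ← Finset.prod_range_add_one_eq_factorial, Nat.cast_prod]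
    refine Finset.prod_congr rfl fun l hl => ?_
    have := Finset.mem_range.1 hl
    rw [Nat.cast_sub (by omega), Nat.cast_sub (by omega)]
    push_cast
    ring
  have hset : (Finset.range (i + d + 1)).erase i =
      Finset.range i ∪ (Finset.range d).image fun l => i + 1 + l := by
    ext l
    simp only [Finset.mem_erase, Finset.mem_range, Finset.mem_union, Finset.mem_image]
    constructor
    · rintro ⟨h₁, h₂⟩
      rcases lt_or_gt_of_ne h₁ with h | h
      · exact Or.inl h
      · exact Or.inr ⟨l - (i + 1), by omega, by omega⟩
    · rintro (h | ⟨k, hk, rfl⟩) <;> omega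
  have hdisj : Disjoint (Finset.range i) ((Finset.range d).image fun l => i + 1 + l) := by
    rw [Finset.disjoint_left]
    intro l hl hl'
    obtain ⟨k, -, rfl⟩ := Finset.mem_image.1 hl'
    have := Finset.mem_range.1 hl
    omega
  rw [hset, Finset.prod_union hdisj, hlow, Finset.prod_image fun a _ b _ h => by simpa using h,
    ← Finset.prod_range_add_one_eq_factorial d, Nat.cast_prod]
  congr 1
  conv_rhs => rw [← Finset.card_range d, ← Finset.prod_const, Finset.card_range,
    ← Finset.prod_mul_distrib]
  refine Finset.prod_congr rfl fun l _ => ?_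
  push_cast
  ring

/-- The divided difference at the nodes `v - m, …, v` is an iterated difference divided by `m!`. -/
theorem sum_div_prod_erase_eq_fwdDiff (f : ℂ → ℂ) (m : ℕ) (v : ℤ) :
    ∑ k ∈ Finset.Icc (v - m) v, f k / ∏ l ∈ (Finset.Icc (v - m) v).erase k, ((k : ℂ) - l) =
      (fwdDiff 1)^[m] f ((v : ℂ) - m) / m.factorial := by
  have hicc : Finset.Icc (v - m) v = (Finset.range (m + 1)).image fun i : ℕ => v - m + i := by
    ext k
    simp only [Finset.mem_Icc, Finset.mem_image, Finset.mem_range]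
    constructor
    · rintro ⟨h₁, h₂⟩
      exact ⟨(k - (v - m)).toNat, by omega, by omega⟩
    · rintro ⟨i, hi, rfl⟩
      omega
  have hinj : Function.Injective fun i : ℕ => v - m + i := fun a b h => by simpa using h
  rw [hicc, Finset.sum_image hinj.injOn, fwdDiff_iter_eq_sum_shift, Finset.sum_div]
  refine Finset.sum_congr rfl fun i hi => ?_
  obtain ⟨d, rfl⟩ : ∃ d, m = i + d := ⟨m - i, by have := Finset.mem_range.1 hi; omega⟩
  rw [← Finset.image_erase hinj, Finset.prod_image hinj.injOn]
  have hprod : ∏ l ∈ (Finset.range (i + d + 1)).erase i,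
      (((v - (i + d : ℕ) + i : ℤ) : ℂ) - ((v - (i + d : ℕ) + l : ℤ) : ℂ)) =
        i.factorial * ((-1) ^ d * d.factorial) := by
    rw [← prod_range_erase_sub]
    refine Finset.prod_congr rfl fun l _ => ?_
    push_cast
    ring
  rw [hprod, Nat.add_sub_cancel_left]
  have hch : ((i + d).choose i : ℂ) * i.factorial * d.factorial = (i + d).factorial := by
    rw [Nat.choose_symm_add]
    exact_mod_cast Nat.add_choose_mul_factorial_mul_factorial i d
  have harg : (((v - (i + d : ℕ) + i : ℤ)) : ℂ) = (v : ℂ) - (i + d : ℕ) + i • (1 : ℂ) := by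
    push_cast
    simp
  have h1 : (i.factorial : ℂ) ≠ 0 := Nat.cast_ne_zero.2 i.factorial_ne_zero
  have h2 : (d.factorial : ℂ) ≠ 0 := Nat.cast_ne_zero.2 d.factorial_ne_zero
  have h3 : ((i + d).factorial : ℂ) ≠ 0 := Nat.cast_ne_zero.2 (i + d).factorial_ne_zero
  have h4 : ((-1 : ℂ) ^ d) * (-1) ^ d = 1 := by rw [← mul_pow]; simp
  have h5 : ((-1 : ℂ) ^ d) ≠ 0 := pow_ne_zero _ (by norm_num)
  rw [harg, zsmul_eq_mul, div_eq_div_iff (mul_ne_zero h1 (mul_ne_zero h5 h2)) h3, ← hch]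
  generalize f ((v : ℂ) - (i + d : ℕ) + i • (1 : ℂ)) = y
  push_cast
  linear_combination (-(((i + d).choose i : ℂ) * i.factorial * d.factorial * y)) * h4

/-- The `j`-th Lagrange basis polynomial of the top row. -/
noncomputable def topBasis {n : ℕ} (x : Fin n → ℤ) (j : Fin n) : Polynomial ℂ :=
  Lagrange.basis Finset.univ (fun i => (x i : ℂ)) j

/-- The iterated backward difference `∇^(n - s) L_j (v)` of the `j`-th Lagrange basis polynomial,
written with forward differences. -/
noncomputable def topSolution {n : ℕ} (x : Fin n → ℤ) (j : Fin n) (s : ℕ) (v : ℤ) : ℂ :=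
  (fwdDiff 1)^[n - s] (fun z => (topBasis x j).eval z) ((v : ℂ) - (n - s : ℕ))

section topSolution

variable {n : ℕ} {x : Fin n → ℤ}

theorem injOn_cast_of_strictAnti (hx : StrictAnti x) :
    Set.InjOn (fun i => (x i : ℂ)) (Finset.univ : Finset (Fin n)) :=
  fun _ _ _ _ h => hx.injective (Int.cast_injective h)

theorem topSolution_zero (hx : StrictAnti x) (j : Fin n) (v : ℤ) : topSolution x j 0 v = 0 := by
  have hdeg : (topBasis x j).natDegree < n := by
    rw [topBasis, Lagrange.natDegree_basis (injOn_cast_of_strictAnti hx) (Finset.mem_univ j),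
      Finset.card_fin]
    have := j.2
    omega
  rw [topSolution, Nat.sub_zero, Polynomial.fwdDiff_iter_eq_zero_of_degree_lt hdeg]
  rfl

theorem topSolution_sub (j : Fin n) (s : ℕ) (hs : s < n) (v : ℤ) :
    topSolution x j (s + 1) v - topSolution x j (s + 1) (v - 1) = topSolution x j s v := by
  obtain ⟨m, hm⟩ : ∃ m, n - s = m + 1 := ⟨n - s - 1, by omega⟩
  have hm' : n - (s + 1) = m := by omega
  simp only [topSolution, hm, hm', Function.iterate_succ_apply']
  have h1 : (v : ℂ) - ((m + 1 : ℕ) : ℂ) + 1 = v - m := by push_cast; ring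
  have h2 : (v : ℂ) - ((m + 1 : ℕ) : ℂ) = ((v - 1 : ℤ) : ℂ) - m := by push_cast; ring
  rw [fwdDiff, h1, h2]

theorem topSolution_top (hx : StrictAnti x) (j b : Fin n) :
    topSolution x j n (x b) = if j = b then 1 else 0 := by
  simp only [topSolution, Nat.sub_self, Function.iterate_zero, id, Nat.cast_zero, sub_zero]
  split_ifs with h
  · subst h
    exact Lagrange.eval_basis_self (v := fun i => (x i : ℂ)) (injOn_cast_of_strictAnti hx)
      (Finset.mem_univ j)
  · exact Lagrange.eval_basis_of_ne (v := fun i => (x i : ℂ)) h (Finset.mem_univ b)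

theorem eval_topBasis (j : Fin n) (w : ℂ) : (topBasis x j).eval w =
    (∏ i ∈ Finset.univ.erase j, (w - x i)) / ∏ i ∈ Finset.univ.erase j, ((x j : ℂ) - x i) := by
  rw [topBasis, Lagrange.basis, Polynomial.eval_prod, ← Finset.prod_div_distrib]
  refine Finset.prod_congr rfl fun i _ => ?_
  simp only [Lagrange.basisDivisor, Polynomial.eval_mul, Polynomial.eval_C, Polynomial.eval_sub,
    Polynomial.eval_X]
  rw [div_eq_inv_mul]

/-- The inner contour integral of the kernel: the residues at the points `x j ≥ u`, the pole `w`
lying outside `Γ`. -/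
theorem integral_kernel_inner (hx : StrictAnti x) (Γ : ClosedContour) (u : ℤ)
    (hΓ : ∀ j, (u ≤ x j → Γ.Encloses (x j)) ∧ (x j < u → Γ.Excludes (x j))) {w : ℂ}
    (hw : Γ.Excludes w) (Q : Polynomial ℂ) (D : ℂ) :
    Γ.integral (fun z => Q.eval z / D * (∏ i : Fin n, (w - x i) / (z - x i)) * (1 / (w - z))) =
      2 * Real.pi * Complex.I *
        ∑ j, (if u ≤ x j then Q.eval (x j : ℂ) else 0) * (topBasis x j).eval w / D := by
  have hxΓ : ∀ j, (x j : ℂ) ∉ Γ.trace := fun j => by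
    rcases le_or_gt u (x j) with h | h
    · exact ((hΓ j).1 h).1
    · exact ((hΓ j).2 h).1
  by_cases hwx : ∃ i, w = x i
  · -- A point of the top row lying outside `Γ`: both sides vanish.
    obtain ⟨i, rfl⟩ := hwx
    have hlt : ¬ u ≤ x i := fun h => one_ne_zero (((hΓ i).1 h).2.symm.trans hw.2)
    have hz : ∀ z, ∏ l : Fin n, ((x i : ℂ) - x l) / (z - x l) = 0 := fun z =>
      Finset.prod_eq_zero (Finset.mem_univ i) (by simp)
    rw [Finset.sum_eq_zero, mul_zero]
    · simp only [hz, mul_zero, zero_mul]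
      simp [ClosedContour.integral]
    · intro j _
      split_ifs with hj
      · have hij : i ≠ j := fun h => hlt (h ▸ hj)
        rw [eval_topBasis, Finset.prod_eq_zero (Finset.mem_erase.2 ⟨hij, Finset.mem_univ i⟩)
          (sub_self _)]
        simp
      · simp
  push Not at hwx
  set a : Option (Fin n) → ℂ := fun o => o.elim w fun i => (x i : ℂ) with ha
  have hinj : Set.InjOn a (Finset.univ : Finset (Option (Fin n))) := by
    rintro (_ | i) - (_ | k) - h
    · rfl
    · exact absurd h (hwx k)
    · exact absurd h.symm (hwx i)
    · exact congrArg some (hx.injective (Int.cast_injective (h : (x i : ℂ) = x k)))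
  have htr : ∀ o ∈ (Finset.univ : Finset (Option (Fin n))), a o ∉ Γ.trace := by
    rintro (_ | i) -
    · exact hw.1
    · exact hxΓ i
  set P : Polynomial ℂ := Polynomial.C (-(∏ i : Fin n, (w - x i)) / D) * Q with hP
  have hres := Γ.integral_eval_div_prod Finset.univ a hinj htr P
  have herase : ∀ j : Fin n, ∏ o ∈ Finset.univ.erase (some j), ((x j : ℂ) - a o) =
      (x j - w) * ∏ i ∈ Finset.univ.erase j, ((x j : ℂ) - x i) := by
    intro j
    have : (Finset.univ : Finset (Option (Fin n))).erase (some j) =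
        Finset.insertNone (Finset.univ.erase j) := by
      ext (_ | i) <;> simp
    rw [this, Finset.prod_insertNone]
    rfl
  rw [Γ.integral_congr (g := fun z => P.eval z / ∏ o, (z - a o)), hres, Fintype.sum_option]
  · rw [show a none = w from rfl, hw.2, zero_mul, zero_add]
    congr 1
    refine Finset.sum_congr rfl fun j _ => ?_
    rw [show a (some j) = x j from rfl, herase, eval_topBasis]
    split_ifs with hj
    · rw [((hΓ j).1 hj).2, hP, Polynomial.eval_mul, Polynomial.eval_C,
        ← Finset.mul_prod_erase Finset.univ (fun i => w - (x i : ℂ)) (Finset.mem_univ j)]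
      have h1 : (x j : ℂ) - w ≠ 0 := sub_ne_zero.2 fun h => hwx j h.symm
      have h2 : ∏ i ∈ Finset.univ.erase j, ((x j : ℂ) - x i) ≠ 0 :=
        Finset.prod_ne_zero_iff.2 fun i hi => sub_ne_zero.2 fun h =>
          (Finset.mem_erase.1 hi).1 (hx.injective (Int.cast_injective h)).symm
      rcases eq_or_ne D 0 with rfl | hD
      · simp
      field_simp
      ring
    · rw [((hΓ j).2 (not_le.1 hj)).2]
      simp
  · intro z hz
    have h1 : w - z ≠ 0 := sub_ne_zero.2 fun h => hw.1 (h ▸ hz)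
    have h1' : z - w ≠ 0 := sub_ne_zero.2 fun h => hw.1 (h ▸ hz)
    have h2 : ∏ i, (z - (x i : ℂ)) ≠ 0 :=
      Finset.prod_ne_zero_iff.2 fun i _ => sub_ne_zero.2 fun h => hxΓ i (h ▸ hz)
    simp only [Fintype.prod_option, ha, Option.elim, hP, Polynomial.eval_mul, Polynomial.eval_C,
      Finset.prod_div_distrib]
    rcases eq_or_ne D 0 with rfl | hD
    · simp
    rw [← neg_sub z w]
    field_simp

/-- The kernel in closed form. As a function of `(s, v)` its negative solves the difference equations
with weight `1` and a unit source at `(r, u)`, and the Lagrange basis makes it vanish at the points of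
the top row. -/
theorem interlacingKernel_eq (hx : StrictAnti x) (Γ γ : ClosedContour) (p q : Site n)
    (hΓ : ∀ j, (p.2 ≤ x j → Γ.Encloses (x j)) ∧ (x j < p.2 → Γ.Excludes (x j)))
    (hγΓ : ∀ z ∈ Γ.trace, γ.Encloses z)
    (hγ : ∀ k ∈ Set.Icc (q.2 - (n : ℤ) + (q.1 : ℕ)) q.2, γ.Encloses (k : ℂ)) :
    interlacingKernel x Γ γ p q = -rowTransition (q.1 - p.1) p.2 q.2 +
      ∑ j, rowTransition (n - p.1) p.2 (x j) * topSolution x j q.1 q.2 := by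
  obtain ⟨⟨r, hr1, hrn⟩, u⟩ := p
  obtain ⟨⟨s, hs1, hsn⟩, v⟩ := q
  simp only at hΓ hγ ⊢
  unfold interlacingKernel
  simp only
  have hI : (2 * Real.pi * Complex.I : ℂ) ≠ 0 := Complex.two_pi_I_ne_zero
  set Q : Polynomial ℂ := ∏ k ∈ Finset.Icc (u + r - n + 1) (u - 1),
    (Polynomial.X - Polynomial.C (k : ℂ)) with hQ
  have hQz : ∀ z : ℂ, ∏ k ∈ Finset.Icc (u + r - n + 1) (u - 1), (z - (k : ℂ)) = Q.eval z :=
    fun z => by simp [hQ, Polynomial.eval_prod]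
  have hQa : ∀ z : ℂ, Q.eval z = (ascPochhammer ℂ (n - r - 1)).eval (z - u + 1) := fun z => by
    rw [← hQz, ← prod_Icc_sub_eq_ascPochhammer]
    congr 2
    rw [Nat.cast_sub (by omega), Nat.cast_sub (by omega)]
    push_cast
    ring
  have hicc : Finset.Icc (v + s - n) v = Finset.Icc (v - (n - s : ℕ)) v := by
    congr 1
    rw [Nat.cast_sub hsn.le]
    ring
  set T : Polynomial ℂ := ∑ j, Polynomial.C
    (2 * Real.pi * Complex.I * if u ≤ x j then Q.eval (x j : ℂ) else 0) * topBasis x j with hT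
  have henc : ∀ k ∈ Finset.Icc (v - (n - s : ℕ)) v, γ.Encloses (k : ℂ) := fun k hk => by
    refine hγ k ?_
    rw [Finset.mem_Icc, Nat.cast_sub hsn.le] at hk
    exact ⟨by linarith [hk.1], hk.2⟩
  have houter : (γ.integral fun w => Γ.integral fun z =>
        (∏ k ∈ Finset.Icc (u + r - n + 1) (u - 1), (z - k)) /
            (∏ k ∈ Finset.Icc (v + s - n) v, (w - k)) *
          (∏ i : Fin n, (w - x i) / (z - x i)) * (1 / (w - z))) =
      2 * Real.pi * Complex.I * ∑ j, (2 * Real.pi * Complex.I *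
        if u ≤ x j then Q.eval (x j : ℂ) else 0) *
          (topSolution x j s v / ((n - s).factorial : ℂ)) := by
    rw [γ.integral_congr (g := fun w => T.eval w /
      ∏ k ∈ Finset.Icc (v - (n - s : ℕ)) v, (w - (k : ℂ)))]
    · rw [γ.integral_eval_div_prod _ (fun k : ℤ => (k : ℂ)) Int.cast_injective.injOn
        (fun k hk => (henc k hk).1)]
      congr 1
      simp only [topSolution, ← sum_div_prod_erase_eq_fwdDiff, Finset.mul_sum]
      rw [Finset.sum_comm]
      refine Finset.sum_congr rfl fun k hk => ?_
      rw [(henc k hk).2, one_mul, hT, Polynomial.eval_finsetSum, Finset.sum_div]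
      refine Finset.sum_congr rfl fun j _ => ?_
      rw [Polynomial.eval_mul, Polynomial.eval_C, mul_div_assoc]
    · intro w hw
      simp only [hQz, hicc]
      rw [integral_kernel_inner hx Γ u hΓ (ClosedContour.excludes_of_encloses Γ γ hγΓ hw) Q, hT,
        Polynomial.eval_finsetSum, Finset.sum_div, Finset.mul_sum]
      refine Finset.sum_congr rfl fun j _ => ?_
      rw [Polynomial.eval_mul, Polynomial.eval_C]
      ring
  rw [houter]
  congr 1
  · unfold rowTransition
    have : (r < s ∧ u ≤ v) ↔ (0 < s - r ∧ u ≤ v) := by rw [Nat.sub_pos_iff_lt]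
    simp only [this]
    split_ifs <;> simp
  · simp only [Finset.mul_sum]
    refine Finset.sum_congr rfl fun j _ => ?_
    have hf1 : ((n - s).factorial : ℂ) ≠ 0 := Nat.cast_ne_zero.2 (n - s).factorial_ne_zero
    have hpos : 0 < n - r := by omega
    unfold rowTransition
    simp only [hpos, true_and]
    split_ifs
    · rw [hQa]
      field_simp
    · simp

end topSolution

/-! ### The law of the interlacing process -/

theorem PointConfig.measurable_prodOneSub {X : Type*} [MetricSpace X] [MeasurableSpace X]
    [MeasurableSingletonClass X] (φ : X → ℂ) (S : Finset X) (hS : Function.support φ ⊆ S) :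
    Measurable fun ξ : PointConfig X => ξ.prodOneSub φ := by
  have hmult : ∀ a : X, Measurable fun ξ : PointConfig X => ξ.multiplicity a := fun a =>
    Nat.measurable_floor.comp (ENNReal.measurable_toReal.comp
      ((Measure.measurable_coe (measurableSet_singleton a)).comp measurable_subtype_coe))
  have heq : (fun ξ : PointConfig X => ξ.prodOneSub φ) =
      fun ξ => ∏ a ∈ S, (1 - φ a) ^ ξ.multiplicity a := by
    ext ξ
    refine finprod_eq_prod_of_mulSupport_subset _ fun a ha => hS ?_
    rw [Function.mem_mulSupport] at ha
    rw [Function.mem_support]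
    intro h0
    simp [h0] at ha
  rw [heq]
  exact Finset.measurable_fun_prod S fun a _ =>
    (measurable_from_nat (f := fun k => (1 - φ a) ^ k)).comp (hmult a)

theorem multiplicity_particles {n : ℕ} (y : TriangularArray n) (a : Site n) :
    (particles y).multiplicity a =
      (Finset.univ.filter fun i : (r : ↥(Set.Ico 1 n)) × Fin (r : ℕ) =>
        (i.1, y ⟨i.1, Nat.lt_succ_of_lt i.1.2.2⟩ i.2) = a).card := by
  classical
  have h : (particles y).1 {a} =
      ((Finset.univ.filter fun i : (r : ↥(Set.Ico 1 n)) × Fin (r : ℕ) =>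
        (i.1, y ⟨i.1, Nat.lt_succ_of_lt i.1.2.2⟩ i.2) = a).card : ENNReal) := by
    rw [Finset.card_filter, Fintype.sum_sigma]
    simp [particles, particleMeasure, Set.indicator_apply]
  rw [PointConfig.multiplicity, h, ENNReal.toReal_natCast, Nat.floor_natCast]

theorem prodOneSub_particles {n : ℕ} (y : TriangularArray n) (φ : Site n → ℂ) :
    (particles y).prodOneSub φ = patternWeight (fun r u => 1 - extendSite φ r u) y := by
  classical
  set pos : (r : ↥(Set.Ico 1 n)) × Fin (r : ℕ) → Site n :=
    fun i => (i.1, y ⟨i.1, Nat.lt_succ_of_lt i.1.2.2⟩ i.2) with hpos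
  have h1 : (particles y).prodOneSub φ = ∏ i, (1 - φ (pos i)) := by
    rw [Finset.prod_comp (fun a => 1 - φ a) pos, PointConfig.prodOneSub]
    simp only [multiplicity_particles]
    refine finprod_eq_prod_of_mulSupport_subset _ fun a ha => ?_
    rw [Function.mem_mulSupport] at ha
    by_contra hn
    refine ha ?_
    rw [Finset.card_eq_zero.2, pow_zero]
    refine Finset.filter_eq_empty_iff.2 fun i _ hi => hn ?_
    exact Finset.mem_coe.2 (Finset.mem_image.2 ⟨i, Finset.mem_univ _, hi⟩)
  rw [h1, Fintype.prod_sigma, patternWeight]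
  have h2 : ∀ r : ↥(Set.Ico 1 n), ∏ i : Fin (r : ℕ), (1 - φ (pos ⟨r, i⟩)) =
      ∏ i : Fin (r : ℕ), (1 - extendSite φ r (y ⟨r, Nat.lt_succ_of_lt r.2.2⟩ i)) := fun r =>
    Finset.prod_congr rfl fun i _ => by rw [← extendSite_coe φ (pos ⟨r, i⟩)]
  simp only [h2]
  -- Row `0` is empty, so that leaving it out does not change the product.
  refine Fintype.prod_of_injective (fun r : ↥(Set.Ico 1 n) => (⟨r, r.2.2⟩ : Fin n)) ?_ _ _ ?_ ?_
  · intro r r' h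
    exact Subtype.ext (by simpa using h)
  · intro r hr
    have h0 : (r : ℕ) = 0 := by
      by_contra h
      exact hr ⟨⟨r, by rw [Set.mem_Ico]; omega⟩, rfl⟩
    exact Finset.prod_eq_one fun i _ => absurd i.2 (by omega)
  · intro r
    rfl

theorem integrableOn_count_finset {Ω : Type*} [MeasurableSpace Ω] [MeasurableSingletonClass Ω]
    (T : Finset Ω) (f : Ω → ℂ) : IntegrableOn f T Measure.count := by
  have hfin : IsFiniteMeasure (Measure.count.restrict (T : Set Ω)) :=
    ⟨by simp [Measure.count_apply_finset]⟩
  have := IntegrableOn.finset (μ := Measure.count.restrict (T : Set Ω)) (s := T) (f := f)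
  rwa [IntegrableOn, Measure.restrict_restrict T.measurableSet, inter_self] at this

theorem integrable_uniformOn_finset {Ω : Type*} [MeasurableSpace Ω] [MeasurableSingletonClass Ω]
    {T : Finset Ω} (hT : T.Nonempty) (f : Ω → ℂ) :
    Integrable f (ProbabilityTheory.uniformOn (T : Set Ω)) := by
  rw [ProbabilityTheory.uniformOn, ProbabilityTheory.cond]
  refine Integrable.smul_measure (integrableOn_count_finset T f) ?_
  simp [Measure.count_apply_finset, hT.ne_empty]

theorem integral_uniformOn_finset {Ω : Type*} [MeasurableSpace Ω] [MeasurableSingletonClass Ω]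
    (T : Finset Ω) (f : Ω → ℂ) :
    ∫ y, f y ∂(ProbabilityTheory.uniformOn (T : Set Ω)) = (T.card : ℂ)⁻¹ * ∑ y ∈ T, f y := by
  rw [ProbabilityTheory.uniformOn, ProbabilityTheory.cond, integral_smul_measure,
    setIntegral_finset _ (integrableOn_count_finset T f)]
  simp [Measure.count_apply_finset, measureReal_def, Finset.mul_sum]

theorem finite_of_isBounded_site {n : ℕ} (B : Set (Site n)) (hB : Bornology.IsBounded B) :
    B.Finite :=
  (Metric.isCompact_of_isClosed_isBounded (isClosed_discrete B) hB).finite_of_discrete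

theorem exists_window {n : ℕ} (x : Fin n → ℤ) (S : Finset (Site n)) :
    ∃ A B : ℤ, (∀ i, A ≤ x i) ∧ (∀ i, x i ≤ B) ∧ ∀ p ∈ S, p.2 ∈ Finset.Ioc A B := by
  set F : Finset ℤ := Finset.univ.image x ∪ S.image Prod.snd with hF
  have hle : ∀ k ∈ F, k.natAbs ≤ F.sup Int.natAbs := fun k hk => Finset.le_sup hk
  refine ⟨-(F.sup Int.natAbs : ℕ) - 1, (F.sup Int.natAbs : ℕ), fun i => ?_, fun i => ?_,
    fun p hp => ?_⟩
  · have := hle (x i) (by simp [hF])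
    omega
  · have := hle (x i) (by simp [hF])
    omega
  · have := hle p.2 (Finset.mem_union_right _ (Finset.mem_image_of_mem _ hp))
    rw [Finset.mem_Ioc]
    omega

/-- The weighted number of patterns is the number of patterns times the Fredholm determinant: both
are the determinant of solutions at the top row, for two bases related by a matrix `C` that does
not depend on the weight; the weight `1` determines `det C`. -/
theorem sum_patternWeight_eq {n : ℕ} {x : Fin n → ℤ} (hx : StrictAnti x) {A B : ℤ}
    (hA : ∀ i, A ≤ x i) (hB : ∀ i, x i ≤ B) (φ : Site n → ℂ) {S : Finset (Site n)}
    (hS : S = Finset.univ ×ˢ Finset.Ioc A B) [DecidableEq S] (T : Finset (TriangularArray n))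
    (hT : (T : Set (TriangularArray n)) = gtPatterns x) :
    (T.card : ℂ) ≠ 0 ∧
    (T.card : ℂ)⁻¹ * ∑ y ∈ T, patternWeight (fun r u => 1 - extendSite φ r u) y =
      (1 - Matrix.of fun p q : S => φ p * (-rowTransition (q.1.1 - p.1.1) p.1.2 q.1.2 +
        ∑ j, rowTransition (n - p.1.1) p.1.2 (x j) * topSolution x j q.1.1 q.1.2)).det := by
  set C : Matrix (Fin n) (Fin n) ℂ := Matrix.of fun j a => topSolution x j (a + 1) A with hC
  have hdet : ∀ g, (Matrix.of fun j b : Fin n =>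
      evolve A g (fun k => topSolution x j (k + 1) A) n (x b)).det =
        C.det * ∑ y ∈ T, patternWeight g y := by
    intro g
    obtain ⟨T', hT', hsum⟩ := exists_finset_gtPatterns (A := A) g x hx hA
    obtain rfl : T' = T := Finset.coe_injective (hT'.trans hT.symm)
    rw [hsum, ← Matrix.det_mul]
    congr 1
    ext j b
    rw [Matrix.mul_apply]
    exact evolve_eq_sum_single A g _ n n le_rfl (x b)
  have hone : C.det * T.card = 1 := by
    have h := hdet fun _ _ => 1
    have hw : ∑ y ∈ T, patternWeight (fun _ _ => 1) y = T.card := by simp [patternWeight]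
    rw [hw] at h
    rw [← h]
    refine (congrArg Matrix.det ?_).trans Matrix.det_one
    ext j b
    rw [Matrix.of_apply, evolve_one_eq (topSolution x j) n (topSolution_zero hx j)
      (topSolution_sub j) n le_rfl (hA b), topSolution_top hx, Matrix.one_apply]
  refine ⟨right_ne_zero_of_mul_eq_one hone, ?_⟩
  rw [det_one_sub_mul_kernel x hA hB φ (topSolution x) (topSolution_zero hx) topSolution_sub
    (topSolution_top hx) hS, hdet, ← eq_inv_of_mul_eq_one_left hone]

theorem mainTheorem5 (n : ℕ) (x : Fin n → ℤ) (hx : StrictAnti x)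
    (Γ : ℤ → ClosedContour) (γ : Site n → Site n → ClosedContour)
    (hΓ : ∀ (u : ℤ) (j : Fin n),
      (u ≤ x j → (Γ u).Encloses (x j)) ∧ (x j < u → (Γ u).Excludes (x j)))
    (hγ : ∀ p q : Site n,
      (∀ z ∈ (Γ p.2).trace, (γ p q).Encloses z) ∧
      ∀ k ∈ Set.Icc (q.2 - (n : ℤ) + (q.1 : ℕ)) q.2, (γ p q).Encloses (k : ℂ)) :
    IsDeterminantal (interlacingProcess x) Measure.count
      (fun p q => interlacingKernel x (Γ p.2) (γ p q) p q) := by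
  classical
  have hK : ∀ p q, interlacingKernel x (Γ p.2) (γ p q) p q =
      -rowTransition (q.1 - p.1) p.2 q.2 +
        ∑ j, rowTransition (n - p.1) p.2 (x j) * topSolution x j q.1 q.2 := fun p q =>
    interlacingKernel_eq hx (Γ p.2) (γ p q) p q (hΓ p.2) (hγ p q).1 (hγ p q).2
  simp only [hK]
  obtain ⟨A₀, B₀, hA₀, hB₀, -⟩ := exists_window x ∅
  obtain ⟨T, hT, -⟩ := exists_finset_gtPatterns (A := A₀) (fun _ _ => 1) x hx hA₀
  have hcard : (T.card : ℂ) ≠ 0 := (sum_patternWeight_eq hx hA₀ hB₀ 0 rfl T hT).1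
  have hmeas : Measurable (particles (n := n)) := measurable_of_countable _
  have hne : T.Nonempty := Finset.card_ne_zero.1 fun h => hcard (by rw [h, Nat.cast_zero])
  have hunif : IsProbabilityMeasure (ProbabilityTheory.uniformOn (gtPatterns x)) := by
    refine ProbabilityTheory.isProbabilityMeasure_uniformOn ?_ ?_ <;> rw [← hT]
    · exact T.finite_toSet
    · exact Finset.coe_nonempty.2 hne
  refine isDeterminantal_of_integral_eq_det finite_of_isBounded_site _
    (Measure.isProbabilityMeasure_map hmeas.aemeasurable) _ fun φ S₀ hS₀ => ?_
  have hprod := PointConfig.measurable_prodOneSub φ S₀ hS₀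
  obtain ⟨A, B, hA, hB, hS⟩ := exists_window x S₀
  refine ⟨?_, Finset.univ ×ˢ Finset.Ioc A B, fun p hp => ?_, fun _ => ?_⟩
  · rw [integrable_map_measure hprod.aestronglyMeasurable hmeas.aemeasurable, ← hT]
    exact integrable_uniformOn_finset hne _
  · exact Finset.mem_coe.2 (Finset.mem_product.2 ⟨Finset.mem_univ _, hS p (hS₀ hp)⟩)
  · rw [integral_map hmeas.aemeasurable hprod.aestronglyMeasurable, ← hT,
      integral_uniformOn_finset]
    simp only [prodOneSub_particles]
    exact (sum_patternWeight_eq hx hA hB φ rfl T hT).2
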